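/- **Setting.** Let $(W,S)$ be a Coxeter system with Coxeter matrix $(m_{st})$, $m_{ss}=1$, $m_{st}=\infty$ allowed. Let $\mathfrak h^*=\bigoplus_{s\in S}\mathbb R\alpha_s$ with the symmetric bilinear form $(\alpha_s,\alpha_t)=-\cos(\pi/m_{st})$ (equal to $-1$ if $m_{st}=\infty$), put $\langle\lambda,\alpha_s^\vee\rangle=2(\lambda,\alpha_s)/(\alpha_s,\alpha_s)$, and let $W$ act on $\mathfrak h^*$ by $s(\lambda)=\lambda-\langle\lambda,\alpha_s^\vee\rangle\alpha_s$ and hence on $R=\operatorname{Sym}(\mathfrak h^*)$ by algebra automorphisms. The affine nil Hecke algebra $\mathrm{NH}$ is the $\mathbb R$-algebra generated by the vector space $\mathfrak h^*$ and symbols $\partial_s$ ($s\in S$) with the relations $\lambda\mu=\mu\lambda$, $\partial_s\lambda=s(\lambda)\partial_s+\langle\lambda,\alpha_s^\vee\rangle$, $\partial_s^2=0$, and $\partial_s\partial_t\partial_s\cdots=\partial_t\partial_s\partial_t\cdots$ ($m_{st}$ factors on each side) whenever $m_{st}<\infty$. It receives an algebra morphism from $R$ extending $\mathfrak h^*\to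 \mathrm{NH}$. In $\mathrm{NH}$ write $s:=1-\alpha_s\partial_s$. The twisted group algebra $R\star W$ is the free left $R$-module on $W$ with $(rw)(r'w')=r\,w(r')\,ww'$. **Hopf algebroids.** Let $k$ be a field, $R$ a commutative $k$-algebra and $H\supseteq R$ a $k$-algebra. Write $H\otimes_R H$ for the tensor product of left $R$-modules ($rh\otimes h'=h\otimes rh'$) and $H\boxtimes_R H$ for the balanced one ($hr\boxtimes h'=h\boxtimes rh'$). The Takeuchi products $$H\times_R H=\Big\{\textstyle\sum h_i\otimes h_i'\in H\otimes_R H : \sum h_ir\otimes h_i'=\sum h_i\otimes h_i'r\ \ \forall r\in R\Big\},$$ $$H\times_R^{\boxtimes} H^{\mathrm{op}}=\Big\{\textstyle\sum h_i\boxtimes h_i'\in H\boxtimes_R H : \sum rh_i\boxtimes h_i'=\sum h_i\boxtimes h_i'r\ \ \forall r\in R\Big\}$$ are $k$-algebras under the componentwise products $(h\otimes h')(g\otimes g')=hg\otimes h'g'$ and $(h\boxtimes h')(g\boxtimes g')=hg\boxtimes g'h'$, respectively. A left bialgebroid structure on $H$ over $R$ is a coassociative counital coalgebra structure $(\Delta,\varepsilon)$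 on the left $R$-module $H$ such that $\Delta$ is a $k$-algebra morphism $H\to H\times_RH$, and such that $h\mapsto(r\mapsto\varepsilon(hr))$ is a representation of $H$ on $R$ that restricts to the regular representation of $R$. It is a Hopf algebroid if the Galois map $\mathrm{Gal}\colon H\boxtimes_RH\to H\otimes_RH$, $h\boxtimes h'\mapsto h_{(1)}\otimes h_{(2)}h'$, is bijective; its translation map is $\mathrm{red}(h)=\mathrm{Gal}^{-1}(h\otimes1)$. For example, $R\star W$ carries the coalgebra structure $\Delta(rw)=rw\otimes w$, $\varepsilon(rw)=r$. **Theorem (Nil Hecke bialgebroid).** 1. There is an algebra morphism $\rho\colon \mathrm{NH}\to\operatorname{End}_{\mathbb R}(R)$ such that $\rho(\lambda)$ is multiplication by $\lambda$ for $\lambda\in\mathfrak h^*$, and $\alpha_s\cdot\rho(\partial_s)(f)=f-s(f)$ for $s\in S$, $f\in R$. 2. The assignments $$\Delta(\lambda)=\lambda\cdot 1\otimes 1,\qquad \Delta(\partial_s)=\partial_s\otimes s+1\otimes\partial_s=\partial_s\otimes1+s\otimes\partial_s\qquad(\lambda\in\mathfrak h^*,\ s\in S)$$ extend to an $\mathbb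 R$-algebra morphism $\Delta\colon \mathrm{NH}\to \mathrm{NH}\times_R \mathrm{NH}$. 3. The map $R\to\mathrm{NH}$ is injective, and with $\Delta$ and the counit $\varepsilon(h)=\rho(h)(1)$ the algebra $\mathrm{NH}$ is a Hopf algebroid over $R$ which is cocommutative, i.e. $\Delta$ is invariant under the flip of $\mathrm{NH}\otimes_R\mathrm{NH}$. 4. Its translation map is an $\mathbb R$-algebra morphism $\mathrm{red}\colon \mathrm{NH}\to \mathrm{NH}\times_R^{\boxtimes}\mathrm{NH}^{\mathrm{op}}$, given on generators by $$\mathrm{red}(\lambda)=\lambda\boxtimes1,\qquad \mathrm{red}(\partial_s)=\partial_s\boxtimes s+1\boxtimes\partial_s=\partial_s\boxtimes1-s\boxtimes\partial_s .$$ 5. $R\star W$ is a Hopf subalgebroid of $\mathrm{NH}$: $R\star W$ is a Hopf algebroid over $R$, and there is an injective $R$-linear algebra morphism $R\star W\to \mathrm{NH}$ with $s\mapsto 1-\alpha_s\partial_s$ for $s\in S$, which is compatible with the comultiplications and the counits. -/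

import Mathlib

open scoped TensorProduct

noncomputable section

namespace HopfAlgebroid

/-! ### Tensor products of `R`-bimodules

`H` is a ring with a ring homomorphism from the commutative ring `R`, encoded by a left `R`-module
structure compatible with the multiplication of `H`; the homomorphism is `r ↦ r • 1`.
The tensor product of left modules is `H ⊗[R] H`. -/

section Basic

variable (R H : Type*) [CommRing R] [Ring H] [Module R H] [IsScalarTower R H H]

/-- The structure homomorphism `R → H`, `r ↦ r • 1`. -/
def incl : R →+* H where
  toFun r := r • (1 : H)
  map_one' := one_smul _ _
  map_mul' r r' := by rw [smul_mul_assoc, one_mul, mul_smul]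
  map_zero' := zero_smul _ _
  map_add' r r' := add_smul _ _ _

variable {R H} in
theorem incl_mul (r : R) (h : H) : incl R H r * h = r • h := by
  simp [incl, smul_mul_assoc]

/-- A copy of `H`, on which `R` acts by multiplication from the right. -/
def RightCopy (_R H : Type*) : Type _ := H

/-- An element of `H`, seen in the copy of `H`. -/
def toRight (_R : Type*) {H : Type*} (h : H) : RightCopy _R H := h

/-- An element of the copy of `H`, seen in `H`. -/
def ofRight {_R H : Type*} (h : RightCopy _R H) : H := h

instance : AddCommGroup (RightCopy R H) := inferInstanceAs (AddCommGroup H)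

/-- The right regular action `r • h = h r` of the commutative ring `R`. -/
instance : Module R (RightCopy R H) where
  smul r h := toRight R (ofRight h * incl R H r)
  one_smul h := show ofRight h * incl R H 1 = ofRight h by rw [map_one, mul_one]
  mul_smul r r' h := show ofRight h * incl R H (r * r') =
      ofRight h * incl R H r' * incl R H r by
    rw [mul_comm r r', map_mul, mul_assoc]
  smul_zero r := zero_mul (M₀ := H) (incl R H r)
  smul_add r h h' := add_mul (R := H) (ofRight h) (ofRight h') (incl R H r)
  zero_smul h := show ofRight h * incl R H 0 = 0 by rw [map_zero, mul_zero]
  add_smul r r' h := show ofRight h * incl R H (r + r') =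
      ofRight h * incl R H r + ofRight h * incl R H r' by
    rw [map_add, mul_add]

/-- The balanced tensor product `H_R ⊗_R {}_R H`, in which `h r ⊗ h' = h ⊗ r h'`. -/
abbrev BalTensor : Type _ := RightCopy R H ⊗[R] H

/-- The element `h ⊗ h'` of the balanced tensor product. -/
def balTmul (h h' : H) : BalTensor R H := toRight R h ⊗ₜ[R] h'

/-- Multiplication from the right by `a`, as a map of left `R`-modules. -/
def mulR (a : H) : H →ₗ[R] H where
  toFun h := h * a
  map_add' h h' := add_mul h h' a
  map_smul' r h := smul_mul_assoc r h a

/-- Multiplication from the left by `a`, as a map of right `R`-modules. -/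
def mulL (a : H) : RightCopy R H →ₗ[R] RightCopy R H where
  toFun h := toRight R (a * ofRight h)
  map_add' h h' := mul_add (R := H) a (ofRight h) (ofRight h')
  map_smul' r h := (mul_assoc a (ofRight h) (incl R H r)).symm

/-- The map `h ⊗ h' ↦ h a ⊗ h' b` on `H ⊗[R] H`. -/
def actR (a b : H) : H ⊗[R] H →ₗ[R] H ⊗[R] H := TensorProduct.map (mulR R H a) (mulR R H b)

/-- The map `h ⊗ h' ↦ a h ⊗ h' b` on the balanced tensor product. -/
def actB (a b : H) : BalTensor R H →ₗ[R] BalTensor R H :=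
  TensorProduct.map (mulL R H a) (mulR R H b)

variable {R H}

@[simp] theorem actR_tmul (a b h h' : H) :
    actR R H a b (h ⊗ₜ[R] h') = (h * a) ⊗ₜ[R] (h' * b) := rfl

@[simp] theorem actB_balTmul (a b h h' : H) :
    actB R H a b (balTmul R H h h') = balTmul R H (a * h) (h' * b) := rfl

@[elab_as_elim]
theorem bal_induction {p : BalTensor R H → Prop} (x : BalTensor R H) (zero : p 0)
    (tmul : ∀ h h', p (balTmul R H h h')) (add : ∀ x y, p x → p y → p (x + y)) : p x :=
  TensorProduct.induction_on x zero tmul add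

theorem balTmul_balanced (r : R) (h h' : H) :
    balTmul R H (h * incl R H r) h' = balTmul R H h (r • h') :=
  TensorProduct.smul_tmul (R := R) (M := RightCopy R H) r h h'

theorem balTmul_add_left (a a' b : H) :
    balTmul R H (a + a') b = balTmul R H a b + balTmul R H a' b :=
  TensorProduct.add_tmul (R := R) (M := RightCopy R H) a a' b

theorem balTmul_add_right (a b b' : H) :
    balTmul R H a (b + b') = balTmul R H a b + balTmul R H a b' :=
  TensorProduct.tmul_add (R := R) (M := RightCopy R H) a b b'

theorem actR_add_left (a a' b : H) (x : H ⊗[R] H) :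
    actR R H (a + a') b x = actR R H a b x + actR R H a' b x := by
  induction x with
  | zero => simp
  | tmul h h' => simp [mul_add, TensorProduct.add_tmul]
  | add x y hx hy => simp only [map_add, hx, hy]; abel

theorem actR_add_right (a b b' : H) (x : H ⊗[R] H) :
    actR R H a (b + b') x = actR R H a b x + actR R H a b' x := by
  induction x with
  | zero => simp
  | tmul h h' => simp [mul_add, TensorProduct.tmul_add]
  | add x y hx hy => simp only [map_add, hx, hy]; abel

theorem actR_actR (a b c d : H) (x : H ⊗[R] H) :
    actR R H a b (actR R H c d x) = actR R H (c * a) (d * b) x := by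
  induction x with
  | zero => simp
  | tmul h h' => simp [mul_assoc]
  | add x y hx hy => simp only [map_add, hx, hy]

theorem actR_one (x : H ⊗[R] H) : actR R H 1 1 x = x := by
  induction x with
  | zero => simp
  | tmul h h' => simp
  | add x y hx hy => simp only [map_add, hx, hy]

theorem actB_add_left (a a' b : H) (x : BalTensor R H) :
    actB R H (a + a') b x = actB R H a b x + actB R H a' b x := by
  induction x using bal_induction with
  | zero => simp
  | tmul h h' => simp [add_mul, balTmul_add_left]
  | add x y hx hy => simp only [map_add, hx, hy]; abel

theorem actB_add_right (a b b' : H) (x : BalTensor R H) :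
    actB R H a (b + b') x = actB R H a b x + actB R H a b' x := by
  induction x using bal_induction with
  | zero => simp
  | tmul h h' => simp [mul_add, balTmul_add_right]
  | add x y hx hy => simp only [map_add, hx, hy]; abel

theorem actB_actB (a b c d : H) (x : BalTensor R H) :
    actB R H a b (actB R H c d x) = actB R H (a * c) (d * b) x := by
  induction x using bal_induction with
  | zero => simp
  | tmul h h' => simp [mul_assoc]
  | add x y hx hy => simp only [map_add, hx, hy]

theorem actB_one (x : BalTensor R H) : actB R H 1 1 x = x := by
  induction x using bal_induction with
  | zero => simp
  | tmul h h' => simp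
  | add x y hx hy => simp only [map_add, hx, hy]

end Basic

/-! ### Takeuchi products -/

section Takeuchi

variable (R H : Type*) [CommRing R] [Ring H] [Module R H] [IsScalarTower R H H]

/-- The Takeuchi product `H ×_R H`, as a subgroup of `H ⊗[R] H`: all `∑ hᵢ ⊗ hᵢ'` such that
`∑ hᵢ r ⊗ hᵢ' = ∑ hᵢ ⊗ hᵢ' r` for all `r` in `R`. -/
def takeuchi : AddSubgroup (H ⊗[R] H) where
  carrier := {x | ∀ r : R, actR R H (incl R H r) 1 x = actR R H 1 (incl R H r) x}
  zero_mem' r := by simp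
  add_mem' hx hy r := by rw [map_add, map_add, hx r, hy r]
  neg_mem' hx r := by rw [map_neg, map_neg, hx r]

/-- The Takeuchi product of `H` and its opposite, as a subgroup of the balanced tensor product:
all `∑ hᵢ ⊗ hᵢ'` such that `∑ r hᵢ ⊗ hᵢ' = ∑ hᵢ ⊗ hᵢ' r` for all `r` in `R`. -/
def balTakeuchi : AddSubgroup (BalTensor R H) where
  carrier := {x | ∀ r : R, actB R H (incl R H r) 1 x = actB R H 1 (incl R H r) x}
  zero_mem' r := by simp
  add_mem' hx hy r := by rw [map_add, map_add, hx r, hy r]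
  neg_mem' hx r := by rw [map_neg, map_neg, hx r]

variable {R H}

/-- Componentwise multiplication from the left, `(∑ hᵢ ⊗ hᵢ') (a ⊗ b) = ∑ hᵢ a ⊗ hᵢ' b`,
by an element of the Takeuchi product. -/
def takMul (x : H ⊗[R] H) (hx : x ∈ takeuchi R H) : H ⊗[R] H →+ H ⊗[R] H :=
  TensorProduct.liftAddHom
    (AddMonoidHom.mk' (fun a => AddMonoidHom.mk' (fun b => actR R H a b x)
        fun b b' => actR_add_right a b b' x)
      fun a a' => AddMonoidHom.ext fun b => actR_add_left a a' b x)
    fun r a b => by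
      change actR R H (r • a) b x = actR R H a (r • b) x
      have h1 := actR_actR a b (incl R H r) 1 x
      have h2 := actR_actR a b 1 (incl R H r) x
      rw [one_mul, incl_mul] at h1 h2
      rw [← h1, ← h2, hx r]

/-- Componentwise multiplication from the right,
`(a ⊗ b) (∑ hᵢ ⊗ hᵢ') = ∑ a hᵢ ⊗ hᵢ' b`, by an element of the Takeuchi product of `H` and its
opposite. -/
def balMul (y : BalTensor R H) (hy : y ∈ balTakeuchi R H) : BalTensor R H →+ BalTensor R H :=
  TensorProduct.liftAddHom
    (AddMonoidHom.mk' (fun a : RightCopy R H =>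
        AddMonoidHom.mk' (fun b : H => actB R H (ofRight a) b y)
          fun b b' => actB_add_right (ofRight a) b b' y)
      fun a a' => AddMonoidHom.ext fun b => actB_add_left (ofRight a) (ofRight a') b y)
    fun r a b => by
      change actB R H (ofRight a * incl R H r) b y = actB R H (ofRight a) (r • b) y
      have h1 := actB_actB (ofRight a) b (incl R H r) 1 y
      have h2 := actB_actB (ofRight a) b 1 (incl R H r) y
      rw [one_mul] at h1
      rw [mul_one, incl_mul] at h2
      rw [← h1, hy r, h2]

@[simp] theorem takMul_tmul (x : H ⊗[R] H) (hx : x ∈ takeuchi R H) (a b : H) :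
    takMul x hx (a ⊗ₜ[R] b) = actR R H a b x := rfl

@[simp] theorem balMul_balTmul (y : BalTensor R H) (hy : y ∈ balTakeuchi R H) (a b : H) :
    balMul y hy (balTmul R H a b) = actB R H a b y := rfl

theorem takMul_actR (x : H ⊗[R] H) (hx : x ∈ takeuchi R H) (a b : H) (y : H ⊗[R] H) :
    takMul x hx (actR R H a b y) = actR R H a b (takMul x hx y) := by
  induction y with
  | zero => simp
  | tmul h h' => simp [actR_actR]
  | add y z hy hz => simp only [map_add, hy, hz]

theorem balMul_actB (y : BalTensor R H) (hy : y ∈ balTakeuchi R H) (a b : H)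
    (x : BalTensor R H) :
    balMul y hy (actB R H a b x) = actB R H a b (balMul y hy x) := by
  induction x using bal_induction with
  | zero => simp
  | tmul h h' => simp [actB_actB]
  | add y z hy hz => simp only [map_add, hy, hz]

theorem tmul_one_mem (a : H) (ha : ∀ r : R, Commute (incl R H r) a) :
    a ⊗ₜ[R] (1 : H) ∈ takeuchi R H := by
  intro r
  simp only [actR_tmul, mul_one, one_mul]
  rw [← (ha r).eq, incl_mul, ← mul_one (incl R H r), incl_mul, TensorProduct.smul_tmul]

theorem balTmul_one_mem (a : H) (ha : ∀ r : R, Commute (incl R H r) a) :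
    balTmul R H a 1 ∈ balTakeuchi R H := by
  intro r
  simp only [actB_balTmul, mul_one, one_mul]
  rw [(ha r).eq, balTmul_balanced, ← incl_mul, mul_one]

instance : Mul (takeuchi R H) where
  mul x y := ⟨takMul x.1 x.2 y.1, fun r => by
    rw [← takMul_actR, ← takMul_actR, y.2 r]⟩

instance : Mul (balTakeuchi R H) where
  mul x y := ⟨balMul y.1 y.2 x.1, fun r => by
    rw [← balMul_actB, ← balMul_actB, x.2 r]⟩

instance : One (takeuchi R H) where
  one := ⟨1 ⊗ₜ[R] 1, tmul_one_mem 1 fun _ => Commute.one_right _⟩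

instance : One (balTakeuchi R H) where
  one := ⟨balTmul R H 1 1, balTmul_one_mem 1 fun _ => Commute.one_right _⟩

theorem takMul_add (x y z : H ⊗[R] H) (hx : x ∈ takeuchi R H) (hy : y ∈ takeuchi R H)
    (hxy : x + y ∈ takeuchi R H) : takMul (x + y) hxy z = takMul x hx z + takMul y hy z := by
  induction z with
  | zero => simp
  | tmul h h' => simp
  | add y z hy hz => simp only [map_add, hy, hz]; abel

theorem balMul_add (x y z : BalTensor R H) (hx : x ∈ balTakeuchi R H) (hy : y ∈ balTakeuchi R H)
    (hxy : x + y ∈ balTakeuchi R H) : balMul (x + y) hxy z = balMul x hx z + balMul y hy z := by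
  induction z using bal_induction with
  | zero => simp
  | tmul h h' => simp
  | add y z hy hz => simp only [map_add, hy, hz]; abel

theorem takMul_zero (z : H ⊗[R] H) (h0 : 0 ∈ takeuchi R H) : takMul 0 h0 z = 0 := by
  have h := takMul_add 0 0 z h0 h0 (by simp)
  simpa using h

theorem balMul_zero (z : BalTensor R H) (h0 : 0 ∈ balTakeuchi R H) : balMul 0 h0 z = 0 := by
  have h := balMul_add 0 0 z h0 h0 (by simp)
  simpa using h

theorem takMul_takMul (x y : takeuchi R H) (z : H ⊗[R] H) :
    takMul (x * y).1 (x * y).2 z = takMul x.1 x.2 (takMul y.1 y.2 z) := by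
  induction z with
  | zero => simp
  | tmul h h' => rw [takMul_tmul, takMul_tmul, takMul_actR]; rfl
  | add y z hy hz => simp only [map_add, hy, hz]

theorem balMul_balMul (x y : balTakeuchi R H) (z : BalTensor R H) :
    balMul (x * y).1 (x * y).2 z = balMul y.1 y.2 (balMul x.1 x.2 z) := by
  induction z using bal_induction with
  | zero => simp
  | tmul h h' => rw [balMul_balTmul, balMul_balTmul, balMul_actB]; rfl
  | add y z hy hz => simp only [map_add, hy, hz]

theorem takMul_one (z : H ⊗[R] H) : takMul (1 : takeuchi R H).1 (1 : takeuchi R H).2 z = z := by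
  induction z with
  | zero => simp
  | tmul h h' =>
    rw [takMul_tmul]
    change actR R H h h' (1 ⊗ₜ[R] 1) = _
    simp
  | add y z hy hz => simp only [map_add, hy, hz]

theorem balMul_one (z : BalTensor R H) :
    balMul (1 : balTakeuchi R H).1 (1 : balTakeuchi R H).2 z = z := by
  induction z using bal_induction with
  | zero => simp
  | tmul h h' =>
    rw [balMul_balTmul]
    change actB R H h h' (balTmul R H 1 1) = _
    simp
  | add y z hy hz => simp only [map_add, hy, hz]

/-- The ring structure on the Takeuchi product given by componentwise multiplication,
`(∑ᵢ hᵢ ⊗ hᵢ') (∑ⱼ gⱼ ⊗ gⱼ') = ∑ᵢⱼ hᵢ gⱼ ⊗ hᵢ' gⱼ'`. -/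
instance : Ring (takeuchi R H) where
  mul_assoc x y z := Subtype.ext (takMul_takMul x y z.1)
  one_mul x := Subtype.ext (takMul_one x.1)
  mul_one x := Subtype.ext (actR_one x.1)
  left_distrib x y z := Subtype.ext (map_add (takMul x.1 x.2) y.1 z.1)
  right_distrib x y z := Subtype.ext (takMul_add x.1 y.1 z.1 x.2 y.2 (x + y).2)
  zero_mul x := Subtype.ext (takMul_zero x.1 (0 : takeuchi R H).2)
  mul_zero x := Subtype.ext (map_zero (takMul x.1 x.2))
  zsmul := fun n x => n • x
  zsmul_zero' := SubNegMonoid.zsmul_zero'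
  zsmul_succ' := SubNegMonoid.zsmul_succ'
  zsmul_neg' := SubNegMonoid.zsmul_neg'
  neg_add_cancel := neg_add_cancel
  sub_eq_add_neg := sub_eq_add_neg

/-- The ring structure on the Takeuchi product of `H` and its opposite given by componentwise
multiplication, `(∑ᵢ hᵢ ⊗ hᵢ') (∑ⱼ gⱼ ⊗ gⱼ') = ∑ᵢⱼ hᵢ gⱼ ⊗ gⱼ' hᵢ'`. -/
instance : Ring (balTakeuchi R H) where
  mul_assoc x y z := Subtype.ext (balMul_balMul y z x.1).symm
  one_mul x := Subtype.ext (actB_one x.1)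
  mul_one x := Subtype.ext (balMul_one x.1)
  right_distrib x y z := Subtype.ext (map_add (balMul z.1 z.2) x.1 y.1)
  left_distrib x y z := Subtype.ext (balMul_add y.1 z.1 x.1 y.2 z.2 (y + z).2)
  mul_zero x := Subtype.ext (balMul_zero x.1 (0 : balTakeuchi R H).2)
  zero_mul x := Subtype.ext (map_zero (balMul x.1 x.2))
  zsmul := fun n x => n • x
  zsmul_zero' := SubNegMonoid.zsmul_zero'
  zsmul_succ' := SubNegMonoid.zsmul_succ'
  zsmul_neg' := SubNegMonoid.zsmul_neg'
  neg_add_cancel := neg_add_cancel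
  sub_eq_add_neg := sub_eq_add_neg

end Takeuchi

section TakeuchiAlgebra

variable {k R H : Type*} [Field k] [CommRing R] [Ring H] [Algebra k H] [Module R H]
  [IsScalarTower R H H]

theorem takMul_algebraMap (c : k) (hc : algebraMap k H c ⊗ₜ[R] (1 : H) ∈ takeuchi R H)
    (z : H ⊗[R] H) : takMul _ hc z = actR R H (algebraMap k H c) 1 z := by
  induction z with
  | zero => simp
  | tmul h h' => simp [Algebra.commutes c h]
  | add y z hy hz => simp only [map_add, hy, hz]

theorem balMul_algebraMap (c : k) (hc : balTmul R H (algebraMap k H c) 1 ∈ balTakeuchi R H)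
    (z : BalTensor R H) : balMul _ hc z = actB R H (algebraMap k H c) 1 z := by
  induction z using bal_induction with
  | zero => simp
  | tmul h h' => simp [Algebra.commutes c h]
  | add y z hy hz => simp only [map_add, hy, hz]

/-- The `k`-algebra structure of the Takeuchi product, in which a scalar `c` is `c ⊗ 1`. -/
instance : Algebra k (takeuchi R H) :=
  RingHom.toAlgebra'
    { toFun := fun c => ⟨algebraMap k H c ⊗ₜ[R] 1,
        tmul_one_mem _ fun _ => Algebra.commute_algebraMap_right c _⟩
      map_one' := Subtype.ext (congrArg (· ⊗ₜ[R] (1 : H)) (map_one (algebraMap k H)))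
      map_zero' := Subtype.ext (by simp)
      map_mul' := fun c d => Subtype.ext (by
        refine Eq.trans ?_ (takMul_algebraMap (R := R) c _ (algebraMap k H d ⊗ₜ[R] 1)).symm
        rw [actR_tmul, mul_one, ← map_mul, mul_comm])
      map_add' := fun c d => Subtype.ext (by simp [TensorProduct.add_tmul]) }
    fun c x => Subtype.ext (takMul_algebraMap c _ x.1)

/-- The `k`-algebra structure of the Takeuchi product of `H` and its opposite, in which a scalar
`c` is `c ⊗ 1`. -/
instance : Algebra k (balTakeuchi R H) :=
  RingHom.toAlgebra'
    { toFun := fun c => ⟨balTmul R H (algebraMap k H c) 1,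
        balTmul_one_mem _ fun _ => Algebra.commute_algebraMap_right c _⟩
      map_one' := Subtype.ext (congrArg (balTmul R H · 1) (map_one (algebraMap k H)))
      map_zero' := Subtype.ext (by
        simp only [map_zero]
        exact TensorProduct.zero_tmul _ _)
      map_mul' := fun c d => Subtype.ext (by
        refine Eq.trans ?_ (balMul_algebraMap (R := R) d _ (balTmul R H (algebraMap k H c) 1)).symm
        rw [actB_balTmul, mul_one, ← map_mul, mul_comm])
      map_add' := fun c d => Subtype.ext (by simp [balTmul_add_left]) }
    fun c x => Subtype.ext (balMul_algebraMap c _ x.1).symm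

end TakeuchiAlgebra

/-! ### Bialgebroids and Hopf algebroids -/

section Hopf

open Coalgebra

variable (k R H : Type*) [Field k] [CommRing R] [Algebra k R] [Ring H] [Algebra k H] [Module R H]
  [IsScalarTower R H H] [IsScalarTower k R H]

/-- The left `R`-module coalgebra `H` is a left bialgebroid over `R`: the map `R → H` is an
embedding, the comultiplication is a `k`-algebra morphism into the Takeuchi product, and
`h ↦ (r ↦ ε (h r))` is a representation of `H` on `R` extending the regular one. -/
structure IsLeftBialgebroid [Coalgebra R H] : Prop where
  incl_injective : Function.Injective (incl R H)
  comul_algHom : ∃ Δ : H →ₐ[k] takeuchi R H, ∀ h, (Δ h : H ⊗[R] H) = comul (R := R) h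
  counit_rep : ∃ ρ : H →ₐ[k] Module.End k R,
    (∀ h r, ρ h r = counit (R := R) (h * incl R H r)) ∧ ∀ r r' : R, ρ (incl R H r) r' = r * r'

variable {k R H}

theorem IsLeftBialgebroid.comul_mul_incl [Coalgebra R H] (hB : IsLeftBialgebroid k R H)
    (h : H) (r : R) :
    comul (R := R) (h * incl R H r) = actR R H 1 (incl R H r) (comul (R := R) h) := by
  obtain ⟨Δ, hΔ⟩ := hB.comul_algHom
  have hr : (Δ (incl R H r) : H ⊗[R] H) = incl R H r ⊗ₜ[R] 1 := by
    have h1 : comul (R := R) (1 : H) = 1 ⊗ₜ[R] 1 := by rw [← hΔ, map_one]; rfl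
    rw [hΔ]
    change comul (R := R) (r • (1 : H)) = (r • (1 : H)) ⊗ₜ[R] 1
    rw [map_smul, h1, TensorProduct.smul_tmul']
  rw [← hΔ, ← hΔ h, map_mul]
  change takMul (Δ h).1 (Δ h).2 (Δ (incl R H r)).1 = _
  rw [hr, takMul_tmul]
  exact (Δ h).2 r

/-- The Galois map `h ⊗ h' ↦ ∑ h₍₁₎ ⊗ h₍₂₎ h'` from the balanced tensor product to the tensor
product of left modules, where `∑ h₍₁₎ ⊗ h₍₂₎` is the comultiplication of `h`. -/
def galois [Coalgebra R H] (hB : IsLeftBialgebroid k R H) : BalTensor R H →+ H ⊗[R] H :=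
  TensorProduct.liftAddHom
    (AddMonoidHom.mk' (fun h : RightCopy R H =>
        AddMonoidHom.mk' (fun h' : H => actR R H 1 h' (comul (R := R) (ofRight h)))
          fun b b' => actR_add_right 1 b b' _)
      fun a a' => AddMonoidHom.ext fun b => by
        change actR R H 1 b (comul (R := R) (ofRight a + ofRight a')) =
          actR R H 1 b (comul (R := R) (ofRight a)) + actR R H 1 b (comul (R := R) (ofRight a'))
        rw [map_add, map_add])
    fun r a b => by
      change actR R H 1 b (comul (R := R) (ofRight a * incl R H r)) =
        actR R H 1 (r • b) (comul (R := R) (ofRight a))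
      rw [hB.comul_mul_incl, actR_actR, one_mul, incl_mul]

theorem galois_balTmul [Coalgebra R H] (hB : IsLeftBialgebroid k R H) (h h' : H) :
    galois hB (balTmul R H h h') = actR R H 1 h' (comul (R := R) h) := rfl

variable (k R H) in
/-- A Hopf algebroid is a left bialgebroid whose Galois map is bijective. -/
structure IsHopfAlgebroid [Coalgebra R H] : Prop extends IsLeftBialgebroid k R H where
  galois_bijective : Function.Bijective (galois toIsLeftBialgebroid)

/-- The translation map `h ↦ Gal⁻¹ (h ⊗ 1)` of a Hopf algebroid. -/
def IsHopfAlgebroid.red [Coalgebra R H] (hH : IsHopfAlgebroid k R H) (h : H) : BalTensor R H :=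
  (Equiv.ofBijective _ hH.galois_bijective).symm (h ⊗ₜ[R] 1)

variable {A : Type*} [Ring A] [Algebra k A] [Module R A] [IsScalarTower R A A]
  [IsScalarTower k R A]

/-- An `R`-linear algebra morphism, seen as an `R`-linear map. -/
def linearOf (j : A →ₐ[k] H) (hj : ∀ (r : R) (a : A), j (r • a) = r • j a) : A →ₗ[R] H where
  toFun := j
  map_add' := map_add j
  map_smul' := hj

/-- The embedding `j` exhibits the Hopf algebroid `A` over `R` as a Hopf subalgebroid of `H`: it is
`R`-linear and compatible with comultiplication and counit. -/
structure IsHopfSubalgebroid [Coalgebra R A] [Coalgebra R H] (j : A →ₐ[k] H) : Prop where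
  isHopfAlgebroid : IsHopfAlgebroid k R A
  injective : Function.Injective j
  map_smul : ∀ (r : R) (a : A), j (r • a) = r • j a
  map_comul : ∀ a : A, comul (R := R) (j a) =
    TensorProduct.map (linearOf j map_smul) (linearOf j map_smul) (comul (R := R) a)
  map_counit : ∀ a : A, counit (R := R) (j a) = counit (R := R) a

end Hopf

/-! ### The twisted group algebra -/

section TwistedGroupAlgebra

open Coalgebra

variable (R G : Type*) [CommRing R]

/-- The `R`-linear map out of the twisted group algebra with prescribed values on group elements. -/
def twistedLift {P : Type*} [AddCommGroup P] [Module R P] (v : G → P) :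
    SkewMonoidAlgebra R G →ₗ[R] P where
  toFun f := Finsupp.linearCombination R v f.coeff
  map_add' f g := by rw [SkewMonoidAlgebra.coeff_add, map_add]
  map_smul' r f := by rw [SkewMonoidAlgebra.coeff_smul, map_smul]; rfl

variable {R G} in
@[simp] theorem twistedLift_single {P : Type*} [AddCommGroup P] [Module R P] (v : G → P) (g : G)
    (r : R) : twistedLift R G v (SkewMonoidAlgebra.single g r) = r • v g := by
  simp [twistedLift]

/-- The coalgebra structure on the twisted group algebra with `Δ (r g) = r g ⊗ g` and
`ε (r g) = r`. -/
instance : Coalgebra R (SkewMonoidAlgebra R G) where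
  comul := twistedLift R G fun g =>
    SkewMonoidAlgebra.single g (1 : R) ⊗ₜ[R] SkewMonoidAlgebra.single g (1 : R)
  counit := twistedLift R G fun _ => 1
  coassoc := SkewMonoidAlgebra.lhom_ext fun g r => by simp
  rTensor_counit_comp_comul := SkewMonoidAlgebra.lhom_ext fun g r => by
    simp [← TensorProduct.tmul_smul, SkewMonoidAlgebra.smul_single]
  lTensor_counit_comp_comul := SkewMonoidAlgebra.lhom_ext fun g r => by
    simp [TensorProduct.smul_tmul', SkewMonoidAlgebra.smul_single]

end TwistedGroupAlgebra

end HopfAlgebroid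

end

/-! ### The geometric representation and the nil Hecke algebra -/

noncomputable section

namespace CoxeterSystem

section Geometric

variable {B : Type*} (M : CoxeterMatrix B)

/-- The simple root `α_s`, a basis vector of the real vector space `B →₀ ℝ`. -/
def simpleRoot (s : B) : B →₀ ℝ := Finsupp.single s 1

/-- The symmetric bilinear form with `(α_s, α_t) = - cos (π / m_{st})`. For `m_{st} = ∞`, encoded
by `M s t = 0`, the value is `-1`. -/
def form : (B →₀ ℝ) →ₗ[ℝ] (B →₀ ℝ) →ₗ[ℝ] ℝ :=
  Finsupp.linearCombination ℝ fun s => Finsupp.linearCombination ℝ fun t =>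
    -Real.cos (Real.pi / (M s t : ℝ))

/-- The linear form `⟨x, α_s^∨⟩ = 2 (x, α_s) / (α_s, α_s)`. -/
def coroot (s : B) : Module.Dual ℝ (B →₀ ℝ) :=
  (2 / form M (simpleRoot s) (simpleRoot s)) • (form M).flip (simpleRoot s)

/-- The reflection `x ↦ x - ⟨x, α_s^∨⟩ α_s`. -/
def geomReflection (s : B) : Module.End ℝ (B →₀ ℝ) :=
  LinearMap.id - (coroot M s).smulRight (simpleRoot s)

theorem form_simpleRoot (s t : B) :
    form M (simpleRoot s) (simpleRoot t) = -Real.cos (Real.pi / (M s t : ℝ)) := by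
  simp [form, simpleRoot]

theorem coroot_simpleRoot (s t : B) :
    coroot M s (simpleRoot t) = -2 * Real.cos (Real.pi / (M s t : ℝ)) := by
  simp [coroot, form_simpleRoot, M.symmetric t s]

theorem coroot_self (s : B) : coroot M s (simpleRoot s) = 2 := by
  simp [coroot_simpleRoot]

theorem geomReflection_eq (s : B) :
    geomReflection M s = (Module.reflection (coroot_self M s)).toLinearMap := by
  refine LinearMap.ext fun x => ?_
  simp [geomReflection, Module.reflection_apply]

open Polynomial.Chebyshev in
theorem reflection_pow_eq_one {V : Type*} [AddCommGroup V] [Module ℝ V] {x y : V}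
    {f g : Module.Dual ℝ V} (hf : f x = 2) (hg : g y = 2) (m : ℕ) (hm : 2 ≤ m)
    (hfy : f y = -2 * Real.cos (Real.pi / m)) (hgx : g x = -2 * Real.cos (Real.pi / m)) :
    (Module.reflection hf * Module.reflection hg) ^ m = 1 := by
  ext z : 1
  rcases hm.eq_or_lt with rfl | hm3
  · have h1 : f y = 0 := by rw [hfy]; simp
    have h2 : g x = 0 := by rw [hgx]; simp
    simp only [pow_two, LinearEquiv.mul_apply, Module.reflection_apply, map_sub, map_smul, hf, hg,
      h1, h2, LinearEquiv.coe_one, id_eq]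
    module
  have hm0 : (0 : ℝ) < m := by positivity
  have hm3' : (3 : ℝ) ≤ m := by exact_mod_cast hm3
  set θ : ℝ := 2 * (Real.pi / m) with hθ
  have hθm : m * θ = 2 * Real.pi := by rw [hθ]; field_simp
  have hsin : Real.sin θ ≠ 0 := by
    refine (Real.sin_pos_of_pos_of_lt_pi (by positivity) ?_).ne'
    nlinarith [Real.pi_pos]
  have ht : 2 * Real.cos θ = f y * g x - 2 := by
    rw [hfy, hgx, hθ, Real.cos_two_mul]; ring
  rw [Module.reflection_mul_reflection_pow_apply hf hg m z (2 * Real.cos θ) ht]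
  have hS (n : ℤ) : (S ℝ n).eval (2 * Real.cos θ) = Real.sin ((n + 1) * θ) / Real.sin θ := by
    rw [eq_div_iff hsin, S_two_mul_real_cos]
  rcases Nat.even_or_odd' m with ⟨k, rfl | rfl⟩
  · have e1 : (((2 * k : ℕ) : ℤ) - 2) / 2 = (k : ℤ) - 1 := by omega
    have e2 : (((2 * k : ℕ) : ℤ) - 1) / 2 = (k : ℤ) - 1 := by omega
    have hk : (S ℝ ((k : ℤ) - 1)).eval (2 * Real.cos θ) = 0 := by
      rw [hS]
      push_cast at hθm ⊢
      rw [show ((k : ℝ) - 1 + 1) * θ = Real.pi by linarith]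
      simp
    rw [e1, e2, hk]
    simp
  · have e1 : (((2 * k + 1 : ℕ) : ℤ) - 1) / 2 = (k : ℤ) := by omega
    have e2 : (((2 * k + 1 : ℕ) : ℤ) - 3) / 2 = (k : ℤ) - 1 := by omega
    have e3 : ((2 * k + 1 : ℕ) : ℤ) / 2 = (k : ℤ) := by omega
    have e4 : (((2 * k + 1 : ℕ) : ℤ) - 2) / 2 = (k : ℤ) - 1 := by omega
    have hk : (S ℝ (k : ℤ)).eval (2 * Real.cos θ) +
        (S ℝ ((k : ℤ) - 1)).eval (2 * Real.cos θ) = 0 := by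
      rw [hS, hS, ← add_div]
      push_cast at hθm ⊢
      rw [show ((k : ℝ) - 1 + 1) * θ = 2 * Real.pi - ((k : ℝ) + 1) * θ by linarith,
        Real.sin_two_pi_sub]
      simp
    rw [e1, e2, e3, e4, hk]
    simp

theorem geomReflection_isLiftable : M.IsLiftable (geomReflection M) := by
  intro s t
  have key : (Module.reflection (coroot_self M s) * Module.reflection (coroot_self M t)) ^ M s t
      = 1 := by
    by_cases hst : s = t
    · subst hst
      rw [M.diagonal, pow_one]
      exact LinearEquiv.ext fun x => Module.involutive_reflection (coroot_self M s) x
    rcases Nat.eq_zero_or_pos (M s t) with h0 | hpos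
    · rw [h0, pow_zero]
    have hm1 : M s t ≠ 1 := M.off_diagonal s t hst
    exact reflection_pow_eq_one _ _ _ (by omega) (coroot_simpleRoot M s t)
      (by rw [coroot_simpleRoot, M.symmetric t s])
  rw [geomReflection_eq, geomReflection_eq]
  have h := congrArg (LinearEquiv.automorphismGroup.toLinearMapMonoidHom (R := ℝ)) key
  rwa [map_pow, map_mul, map_one] at h

end Geometric

variable {B W : Type*} [Group W] {M : CoxeterMatrix B} (cs : CoxeterSystem M W)

/-- The geometric representation of `W`, in which a simple reflection `s` acts by
`x ↦ x - ⟨x, α_s^∨⟩ α_s`. -/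
def geomRep : W →* Module.End ℝ (B →₀ ℝ) := cs.lift ⟨geomReflection M, geomReflection_isLiftable M⟩

/-- The symmetric algebra `R` of the geometric representation. -/

def SymRing (_cs : CoxeterSystem M W) : Type _ := SymmetricAlgebra ℝ (B →₀ ℝ)

instance : CommRing (SymRing cs) := inferInstanceAs (CommRing (SymmetricAlgebra ℝ (B →₀ ℝ)))

instance : Algebra ℝ (SymRing cs) := inferInstanceAs (Algebra ℝ (SymmetricAlgebra ℝ (B →₀ ℝ)))

/-- A vector of the geometric representation as an element of its symmetric algebra. -/
def symι : (B →₀ ℝ) →ₗ[ℝ] SymRing cs := SymmetricAlgebra.ι ℝ (B →₀ ℝ)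

/-- The action of a group element on `R` by the algebra endomorphism which extends the geometric
representation. -/
def symAct (w : W) : SymRing cs →ₐ[ℝ] SymRing cs :=
  SymmetricAlgebra.lift (A := SymRing cs) (symι cs ∘ₗ geomRep cs w)

theorem symAct_ι (w : W) (x : B →₀ ℝ) : symAct cs w (symι cs x) = symι cs (geomRep cs w x) :=
  SymmetricAlgebra.lift_ι_apply (A := SymRing cs) _ _

theorem sym_hom_ext {A : Type*} [CommRing A] [Algebra ℝ A] {F G : SymRing cs →ₐ[ℝ] A}
    (h : ∀ x, F (symι cs x) = G (symι cs x)) : F = G :=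
  SymmetricAlgebra.algHom_ext (LinearMap.ext h)

instance : MulSemiringAction W (SymRing cs) where
  smul w f := symAct cs w f
  one_smul f := by
    have h : symAct cs 1 = AlgHom.id ℝ _ := sym_hom_ext cs fun x => by
      rw [symAct_ι, map_one]; rfl
    exact DFunLike.congr_fun h f
  mul_smul w w' f := by
    have h : symAct cs (w * w') = (symAct cs w).comp (symAct cs w') := sym_hom_ext cs fun x => by
      rw [AlgHom.comp_apply, symAct_ι, symAct_ι, symAct_ι, map_mul]; rfl
    exact DFunLike.congr_fun h f
  smul_zero w := map_zero (symAct cs w)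
  smul_add w := map_add (symAct cs w)
  smul_one w := map_one (symAct cs w)
  smul_mul w := map_mul (symAct cs w)

instance : SMulCommClass W ℝ (SymRing cs) where
  smul_comm w c f := map_smul (symAct cs w) c f

/-- The alternating product `a b a ⋯` with `n` factors. -/
def altProd {A : Type*} [Monoid A] (a b : A) : ℕ → A
  | 0 => 1
  | n + 1 => a * altProd b a n

/-- The free algebra on the vectors `x` of the geometric representation and the symbols `∂_s`. -/
abbrev FreeNilHecke (B : Type*) : Type _ := FreeAlgebra ℝ ((B →₀ ℝ) ⊕ B)

/-- The generator of the free algebra given by a vector. -/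
abbrev freeWt (x : B →₀ ℝ) : FreeNilHecke B := FreeAlgebra.ι ℝ (Sum.inl x)

/-- The generator `∂_s` of the free algebra. -/
abbrev freeDel (s : B) : FreeNilHecke B := FreeAlgebra.ι ℝ (Sum.inr s)

/-- The defining relations of the nil Hecke algebra. The first two say that the vectors form a
linear subspace. In the last one, `M s t = 0` encodes `m_{st} = ∞` and gives no condition. -/
inductive NilHeckeRel (M : CoxeterMatrix B) : FreeNilHecke B → FreeNilHecke B → Prop
  | add (x y : B →₀ ℝ) : NilHeckeRel M (freeWt (x + y)) (freeWt x + freeWt y)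
  | smul (c : ℝ) (x : B →₀ ℝ) : NilHeckeRel M (freeWt (c • x)) (c • freeWt x)
  | comm (x y : B →₀ ℝ) : NilHeckeRel M (freeWt x * freeWt y) (freeWt y * freeWt x)
  | twistedWeyl (s : B) (x : B →₀ ℝ) : NilHeckeRel M (freeDel s * freeWt x)
      (freeWt (geomReflection M s x) * freeDel s + algebraMap ℝ _ (coroot M s x))
  | nil (s : B) : NilHeckeRel M (freeDel s * freeDel s) 0
  | braid (s t : B) : NilHeckeRel M (altProd (freeDel s) (freeDel t) (M s t))
      (altProd (freeDel t) (freeDel s) (M s t))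

/-- The affine nil Hecke algebra of a Coxeter system. -/
def NilHecke (_cs : CoxeterSystem M W) : Type _ := RingQuot (NilHeckeRel M)

instance : Ring (NilHecke cs) := inferInstanceAs (Ring (RingQuot (NilHeckeRel M)))

instance : Algebra ℝ (NilHecke cs) := inferInstanceAs (Algebra ℝ (RingQuot (NilHeckeRel M)))

/-- The projection from the free algebra. -/
def nhMk : FreeNilHecke B →ₐ[ℝ] NilHecke cs := RingQuot.mkAlgHom ℝ (NilHeckeRel M)

theorem nhMk_rel {a b : FreeNilHecke B} (h : NilHeckeRel M a b) : nhMk cs a = nhMk cs b :=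
  RingQuot.mkAlgHom_rel ℝ h

/-- A vector of the geometric representation as an element of the nil Hecke algebra. -/
def wt : (B →₀ ℝ) →ₗ[ℝ] NilHecke cs where
  toFun x := nhMk cs (freeWt x)
  map_add' x y := by rw [nhMk_rel cs (.add x y), map_add]
  map_smul' c x := by rw [nhMk_rel cs (.smul c x), map_smul]; rfl

/-- The nil Coxeter generator `∂_s`. -/
def del (s : B) : NilHecke cs := nhMk cs (freeDel s)

theorem wt_comm (x y : B →₀ ℝ) : wt cs x * wt cs y = wt cs y * wt cs x := by
  have h := nhMk_rel cs (.comm x y)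
  rwa [map_mul, map_mul] at h

/-- The commutative subalgebra of the nil Hecke algebra generated by the vectors. -/
abbrev wtAlg : Subalgebra ℝ (NilHecke cs) := Algebra.adjoin ℝ (Set.range (wt cs))

instance : CommRing (wtAlg cs) where
  mul_comm := (Algebra.isMulCommutative_adjoin ℝ (by
    rintro _ ⟨x, rfl⟩ _ ⟨y, rfl⟩
    exact wt_comm cs x y) : IsMulCommutative (wtAlg cs)).is_comm.comm

/-- The inclusion of vectors into the subalgebra which they generate. -/
def wtToAlg : (B →₀ ℝ) →ₗ[ℝ] wtAlg cs where
  toFun x := ⟨wt cs x, Algebra.subset_adjoin ⟨x, rfl⟩⟩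
  map_add' x y := Subtype.ext (map_add (wt cs) x y)
  map_smul' c x := Subtype.ext (map_smul (wt cs) c x)

/-- The algebra morphism from `R` to the nil Hecke algebra which extends the inclusion of
vectors. -/
def symIncl : SymRing cs →ₐ[ℝ] NilHecke cs :=
  (wtAlg cs).val.comp (SymmetricAlgebra.lift (wtToAlg cs))

theorem symIncl_ι (x : B →₀ ℝ) : symIncl cs (symι cs x) = wt cs x :=
  congrArg Subtype.val (SymmetricAlgebra.lift_ι_apply (wtToAlg cs) x)

/-- `R` acts on the nil Hecke algebra by multiplication from the left. -/
instance : Module (SymRing cs) (NilHecke cs) :=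
  Module.compHom (NilHecke cs) (symIncl cs).toRingHom

theorem sym_smul_def (r : SymRing cs) (h : NilHecke cs) : r • h = symIncl cs r * h := rfl

instance : IsScalarTower (SymRing cs) (NilHecke cs) (NilHecke cs) where
  smul_assoc r h h' := mul_assoc (symIncl cs r) h h'

instance : IsScalarTower ℝ (SymRing cs) (NilHecke cs) where
  smul_assoc c r h := by
    rw [sym_smul_def, sym_smul_def, map_smul, smul_mul_assoc]

/-- The element `s = 1 - α_s ∂_s` of the nil Hecke algebra. -/
def reflElt (s : B) : NilHecke cs := 1 - wt cs (simpleRoot s) * del cs s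

end CoxeterSystem

end

open HopfAlgebroid CoxeterSystem

/-!
The commutation relation of `∂_s` with `R` says that a module over the nil Hecke algebra is an
`R`-module with operators `d_s` which satisfy the Leibniz rule
`d_s (r n) = ∂_s(r) n + s(r) d_s(n)` over the Demazure operators `∂_s`, square to zero and satisfy
the braid relations. Such connections have tensor products, with operators
`d_s ⊗ 1 + t_s ⊗ d_s` for `t_s = 1 - α_s d_s`, and `Δ(h) = h · (1 ⊗ 1)` in the tensor square of the
regular module. The identities of a cocommutative coalgebra then hold because both sides commute
with the connections and agree at `1`.

The difference of the two sides of a braid relation is semilinear over `R`, hence vanishes as soon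
as it does on generators. On `R` the generator is `1`, which is killed by all Demazure operators. On
the tensor square it is `1 ⊗ 1`, whose images lie in the span of the tensors of alternating words;
alternating words are separated by the polynomials they act on, which reduces the relation to the
one for Demazure operators. The same separation gives the relations of `W` for `1 - α_s ∂_s`.

The nil Hecke algebra has an anti-automorphism `τ` which fixes `R` and all `∂_s`, and `red(h)` is
the image of `Δ(τ(h))` under `a ⊗ b ↦ τ(a) ⊠ b`. That it inverts `Gal` need only be checked on
generators. Finally `w` maps `e_1` to `c e_w + (shorter terms)` with `c ≠ 0` in the nil Coxeter
module `⨁ R e_w`, so that `R ⋆ W` embeds into the nil Hecke algebra.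
-/

noncomputable section

namespace HopfAlgebroid

/-! ### Takeuchi products and the Galois map -/

section Takeuchi

variable {R H : Type*} [CommRing R] [Ring H] [Module R H] [IsScalarTower R H H]

theorem incl_apply (r : R) : incl R H r = r • (1 : H) := rfl

theorem coe_one_balTakeuchi : (1 : balTakeuchi R H).1 = balTmul R H 1 1 := rfl

theorem coe_mul_takeuchi (x y : takeuchi R H) : (x * y).1 = takMul x.1 x.2 y.1 := rfl

theorem coe_mul_balTakeuchi (x y : balTakeuchi R H) : (x * y).1 = balMul y.1 y.2 x.1 := rfl

theorem smul_one_tmul_one_mem_takeuchi (r : R) :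
    r • ((1 : H) ⊗ₜ[R] (1 : H)) ∈ takeuchi R H := fun r' => by
  rw [map_smul, map_smul]
  exact congrArg (r • ·) ((1 : takeuchi R H).2 r')

theorem takMul_smul_one_tmul_one (r : R) (z : H ⊗[R] H) :
    takMul (r • (1 ⊗ₜ[R] 1)) (smul_one_tmul_one_mem_takeuchi r) z = r • z := by
  induction z with
  | zero => simp
  | tmul a b => rw [takMul_tmul, map_smul, actR_tmul, one_mul, one_mul]
  | add x y hx hy => rw [map_add, hx, hy, smul_add]

theorem balTmul_neg_left (a b : H) : balTmul R H (-a) b = -balTmul R H a b :=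
  TensorProduct.neg_tmul (R := R) (toRight R a) b

theorem balTmul_neg_right (a b : H) : balTmul R H a (-b) = -balTmul R H a b :=
  TensorProduct.tmul_neg (R := R) (toRight R a) b

end Takeuchi

section Incl

variable {k R H : Type*} [Field k] [CommRing R] [Algebra k R] [Ring H] [Algebra k H] [Module R H]
  [IsScalarTower R H H] [IsScalarTower k R H]

theorem incl_algebraMap (c : k) : incl R H (algebraMap k R c) = algebraMap k H c := by
  rw [incl_apply, algebraMap_smul, Algebra.algebraMap_eq_smul_one]

variable (k R H)

/-- The source map `r ↦ r ⊗ 1` of `R` into the Takeuchi product. -/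
def inclTakeuchi : R →ₐ[k] takeuchi R H where
  toFun r := ⟨r • (1 ⊗ₜ[R] 1), smul_one_tmul_one_mem_takeuchi r⟩
  map_one' := Subtype.ext (one_smul _ _)
  map_zero' := Subtype.ext (zero_smul _ _)
  map_add' _ _ := Subtype.ext (add_smul _ _ _)
  map_mul' r r' := Subtype.ext <| (mul_smul r r' _).trans (takMul_smul_one_tmul_one r _).symm
  commutes' c := Subtype.ext <| (TensorProduct.smul_tmul' _ _ _).trans
    (congrArg (· ⊗ₜ[R] (1 : H)) (incl_algebraMap c))

/-- The map `r ↦ r ⊠ 1` of `R` into the Takeuchi product of `H` and its opposite. -/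
def inclBalTakeuchi : R →ₐ[k] balTakeuchi R H where
  toFun r := ⟨balTmul R H (incl R H r) 1, balTmul_one_mem _ fun r' =>
    (Commute.all r' r).map (incl R H)⟩
  map_one' := Subtype.ext <| congrArg (balTmul R H · 1) (map_one (incl R H))
  map_zero' := Subtype.ext <|
    (congrArg (balTmul R H · 1) (map_zero (incl R H))).trans (TensorProduct.zero_tmul _ _)
  map_add' r r' := Subtype.ext <| by simp only [map_add, balTmul_add_left, AddMemClass.mk_add_mk]
  map_mul' r r' := Subtype.ext <| by
    simp only [coe_mul_balTakeuchi, balMul_balTmul, actB_balTmul, map_mul, mul_one]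
  commutes' c := Subtype.ext <| congrArg (balTmul R H · 1) (incl_algebraMap c)

variable {k R H}

theorem coe_inclTakeuchi (r : R) : (inclTakeuchi k R H r).1 = r • (1 ⊗ₜ[R] 1) := rfl

theorem coe_inclTakeuchi_mul (r : R) (x : takeuchi R H) :
    (inclTakeuchi k R H r * x).1 = r • x.1 := takMul_smul_one_tmul_one r x.1

theorem coe_mul_inclTakeuchi (x : takeuchi R H) (r : R) :
    (x * inclTakeuchi k R H r).1 = actR R H (incl R H r) 1 x.1 := by
  rw [coe_mul_takeuchi, coe_inclTakeuchi, TensorProduct.smul_tmul', takMul_tmul, incl_apply]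

theorem coe_inclBalTakeuchi_mul (r : R) (x : balTakeuchi R H) :
    (inclBalTakeuchi k R H r * x).1 = actB R H (incl R H r) 1 x.1 := rfl

theorem coe_inclBalTakeuchi (r : R) :
    (inclBalTakeuchi k R H r).1 = balTmul R H (incl R H r) 1 := rfl

end Incl

section Antipode

open MulOpposite

variable {k R H : Type*} [Field k] [CommRing R] [Ring H] [Algebra k H] [Module R H]
  [IsScalarTower R H H] {τ : H →ₐ[k] Hᵐᵒᵖ}
  (hτ : ∀ r : R, τ (incl R H r) = op (incl R H r))

/-- The map `h ⊗ h' ↦ τ(h) ⊠ h'` given by an anti-endomorphism `τ` of `H` which fixes `R`. -/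
def tensorToBal : H ⊗[R] H →+ BalTensor R H :=
  TensorProduct.liftAddHom
    (AddMonoidHom.mk' (fun a => AddMonoidHom.mk' (fun b => balTmul R H (unop (τ a)) b)
        fun b b' => balTmul_add_right _ b b')
      fun a a' => AddMonoidHom.ext fun b => by
        simp only [AddMonoidHom.mk'_apply, AddMonoidHom.add_apply, map_add, unop_add,
          balTmul_add_left])
    fun r a b => by
      simp only [AddMonoidHom.mk'_apply]
      rw [← incl_mul, map_mul, unop_mul, hτ, unop_op, balTmul_balanced]

theorem tensorToBal_tmul (a b : H) :
    tensorToBal hτ (a ⊗ₜ[R] b) = balTmul R H (unop (τ a)) b := rfl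

theorem tensorToBal_actR (a b : H) (z : H ⊗[R] H) :
    tensorToBal hτ (actR R H a b z) = actB R H (unop (τ a)) b (tensorToBal hτ z) := by
  induction z with
  | zero => simp
  | tmul h h' =>
    rw [actR_tmul, tensorToBal_tmul, tensorToBal_tmul, actB_balTmul, map_mul, unop_mul]
  | add x y hx hy => simp only [map_add, hx, hy]

theorem tensorToBal_mem {z : H ⊗[R] H} (hz : z ∈ takeuchi R H) :
    tensorToBal hτ z ∈ balTakeuchi R H := fun r => by
  have h := congrArg (tensorToBal hτ) (hz r)
  rwa [tensorToBal_actR, tensorToBal_actR, hτ, map_one, unop_op, unop_one] at h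

theorem tensorToBal_takMul {x : H ⊗[R] H} (hx : x ∈ takeuchi R H) (z : H ⊗[R] H) :
    tensorToBal hτ (takMul x hx z) =
      balMul (tensorToBal hτ x) (tensorToBal_mem hτ hx) (tensorToBal hτ z) := by
  induction z with
  | zero => simp
  | tmul h h' => rw [takMul_tmul, tensorToBal_tmul, tensorToBal_actR, balMul_balTmul]
  | add x y hx hy => simp only [map_add, hx, hy]

/-- The algebra anti-morphism `h ⊗ h' ↦ τ(h) ⊠ h'` between the Takeuchi products given by an
anti-endomorphism `τ` of `H` which fixes `R`. -/
def takeuchiToBal : takeuchi R H →ₐ[k] (balTakeuchi R H)ᵐᵒᵖ where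
  toFun x := op ⟨tensorToBal hτ x.1, tensorToBal_mem hτ x.2⟩
  map_one' := congrArg op <| Subtype.ext <|
    (tensorToBal_tmul hτ 1 1).trans (by rw [map_one]; rfl)
  map_zero' := congrArg op <| Subtype.ext <| map_zero (tensorToBal hτ)
  map_add' x y := congrArg op <| Subtype.ext <| map_add (tensorToBal hτ) x.1 y.1
  map_mul' x y := congrArg op <| Subtype.ext <| tensorToBal_takMul hτ x.2 y.1
  commutes' c := congrArg op <| Subtype.ext <|
    (tensorToBal_tmul hτ _ 1).trans (by rw [AlgHom.commutes]; rfl)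

end Antipode

section Translation

open Coalgebra

variable {k R H : Type*} [Field k] [CommRing R] [Ring H] [Algebra k H] [Module R H]
  [IsScalarTower R H H]

section Galois

variable [Algebra k R] [Coalgebra R H] (hB : IsLeftBialgebroid k R H)

include hB in
theorem IsLeftBialgebroid.comul_mem (h : H) : comul (R := R) h ∈ takeuchi R H := by
  obtain ⟨Δ, hΔ⟩ := hB.comul_algHom
  exact hΔ h ▸ (Δ h).2

theorem IsLeftBialgebroid.comul_mul (g h : H) :
    comul (R := R) (g * h) = takMul (comul (R := R) g) (hB.comul_mem g) (comul (R := R) h) := by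
  obtain ⟨Δ, hΔ⟩ := hB.comul_algHom
  simp only [← hΔ, map_mul, coe_mul_takeuchi]

include hB in
theorem IsLeftBialgebroid.comul_one : comul (R := R) (1 : H) = 1 ⊗ₜ[R] 1 := by
  obtain ⟨Δ, hΔ⟩ := hB.comul_algHom
  rw [← hΔ, map_one]
  rfl

include hB in
theorem IsLeftBialgebroid.comul_incl (r : R) :
    comul (R := R) (incl R H r) = incl R H r ⊗ₜ[R] 1 := by
  rw [incl_apply, map_smul, hB.comul_one, TensorProduct.smul_tmul']

variable [IsScalarTower k R H]

theorem galois_actB (a b : H) (x : BalTensor R H) : galois hB (actB R H a b x) =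
    takMul (comul (R := R) a) (hB.comul_mem a) (actR R H 1 b (galois hB x)) := by
  induction x using bal_induction with
  | zero => simp
  | tmul h h' =>
    rw [actB_balTmul, galois_balTmul, galois_balTmul, actR_actR, one_mul, hB.comul_mul,
      takMul_actR]
  | add x y hx hy => simp only [map_add, hx, hy]

theorem galois_balMul {a : H} {y : BalTensor R H} (hy : y ∈ balTakeuchi R H)
    (hay : galois hB y = a ⊗ₜ[R] 1) (z : BalTensor R H) :
    galois hB (balMul y hy z) = actR R H a 1 (galois hB z) := by
  induction z using bal_induction with
  | zero => simp
  | tmul g g' =>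
    rw [balMul_balTmul, galois_actB, hay, actR_tmul, takMul_tmul, galois_balTmul, actR_actR]
    simp only [mul_one, one_mul]
  | add x y hx hy => simp only [map_add, hx, hy]

theorem IsHopfAlgebroid.red_eq_of_galois_eq (hH : IsHopfAlgebroid k R H) {h : H}
    {x : BalTensor R H} (hx : galois hH.toIsLeftBialgebroid x = h ⊗ₜ[R] 1) : hH.red h = x := by
  rw [IsHopfAlgebroid.red, Equiv.symm_apply_eq]
  exact hx.symm

end Galois

variable {red : H →ₐ[k] balTakeuchi R H}
  (hred : ∀ r : R, (red (incl R H r)).1 = balTmul R H (incl R H r) 1)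

/-- The map `h ⊗ h' ↦ red(h) (1 ⊠ h')`, which inverts the Galois map if `red` is the translation
map. -/
def translationLift : H ⊗[R] H →+ BalTensor R H :=
  TensorProduct.liftAddHom
    (AddMonoidHom.mk' (fun h : H =>
        AddMonoidHom.mk' (fun h' : H => actB R H 1 h' (red h).1)
          fun b b' => actB_add_right 1 b b' _)
      fun a a' => AddMonoidHom.ext fun b => by
        simp only [AddMonoidHom.mk'_apply, AddMonoidHom.add_apply, map_add, AddSubgroup.coe_add])
    fun r a b => by
      simp only [AddMonoidHom.mk'_apply]
      rw [← incl_mul, map_mul, coe_mul_balTakeuchi, hred, balMul_balTmul, (red a).2 r, actB_actB,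
        one_mul, incl_mul]

theorem translationLift_tmul (a b : H) :
    translationLift hred (a ⊗ₜ[R] b) = actB R H 1 b (red a).1 := rfl

theorem translationLift_actR (a b : H) (x : H ⊗[R] H) :
    translationLift hred (actR R H a b x) =
      actB R H 1 b (balMul (red a).1 (red a).2 (translationLift hred x)) := by
  induction x with
  | zero => simp
  | tmul h h' =>
    rw [actR_tmul, translationLift_tmul, translationLift_tmul, map_mul, coe_mul_balTakeuchi,
      balMul_actB, actB_actB, one_mul]
  | add x y hx hy => simp only [map_add, hx, hy]

theorem translationLift_takMul {g : H} {x : H ⊗[R] H} (hx : x ∈ takeuchi R H)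
    (hgx : translationLift hred x = balTmul R H g 1) (w : H ⊗[R] H) :
    translationLift hred (takMul x hx w) = actB R H g 1 (translationLift hred w) := by
  induction w with
  | zero => simp
  | tmul a b =>
    rw [takMul_tmul, translationLift_actR, hgx, balMul_balTmul, translationLift_tmul, actB_actB,
      actB_actB]
    simp only [mul_one, one_mul]
  | add x y hx hy => simp only [map_add, hx, hy]

variable [Algebra k R] [IsScalarTower k R H] [Coalgebra R H]

theorem galois_bijective_of_translation (hB : IsLeftBialgebroid k R H)
    (h₁ : ∀ h, galois hB (red h).1 = h ⊗ₜ[R] 1)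
    (h₂ : ∀ h, translationLift hred (comul (R := R) h) = balTmul R H h 1) :
    Function.Bijective (galois hB) := by
  refine Function.bijective_iff_has_inverse.2 ⟨translationLift hred, fun x => ?_, fun y => ?_⟩
  · induction x using bal_induction with
    | zero => simp
    | tmul h h' =>
      rw [galois_balTmul, translationLift_actR, h₂, balMul_balTmul, map_one,
        coe_one_balTakeuchi, actB_balTmul, actB_balTmul]
      simp only [one_mul, mul_one]
    | add x y hx hy => simp only [map_add, hx, hy]
  · induction y with
    | zero => simp
    | tmul h h' =>
      rw [translationLift_tmul, galois_actB, h₁, actR_tmul, takMul_tmul, hB.comul_one, actR_tmul]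
      simp only [mul_one, one_mul]
    | add x y hx hy => simp only [map_add, hx, hy]

/-- Both conditions define subalgebras of `H`, because `red` and the comultiplication are
multiplicative. -/
theorem galois_translation_of_adjoin (hB : IsLeftBialgebroid k R H) {s : Set H}
    (hs : Algebra.adjoin k (Set.range (incl R H) ∪ s) = ⊤)
    (h₁ : ∀ h ∈ s, galois hB (red h).1 = h ⊗ₜ[R] 1)
    (h₂ : ∀ h ∈ s, translationLift hred (comul (R := R) h) = balTmul R H h 1) (h : H) :
    galois hB (red h).1 = h ⊗ₜ[R] 1 ∧
      translationLift hred (comul (R := R) h) = balTmul R H h 1 := by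
  have of_incl (r : R) : galois hB (red (incl R H r)).1 = incl R H r ⊗ₜ[R] 1 ∧
      translationLift hred (comul (R := R) (incl R H r)) = balTmul R H (incl R H r) 1 := by
    rw [hred, galois_balTmul, hB.comul_incl, actR_one, translationLift_tmul, hred, actB_one]
    exact ⟨rfl, rfl⟩
  induction (hs ▸ Algebra.mem_top : h ∈ Algebra.adjoin k (Set.range (incl R H) ∪ s))
    using Algebra.adjoin_induction with
  | mem x hx =>
    rcases hx with ⟨r, rfl⟩ | hx
    · exact of_incl r
    · exact ⟨h₁ x hx, h₂ x hx⟩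
  | algebraMap c => exact incl_algebraMap (R := R) (H := H) c ▸ of_incl (algebraMap k R c)
  | add x y _ _ hx hy =>
    rw [map_add, AddSubgroup.coe_add, map_add, hx.1, hy.1, TensorProduct.add_tmul, map_add, map_add,
      hx.2, hy.2, balTmul_add_left]
    exact ⟨rfl, rfl⟩
  | mul x y _ _ hx hy =>
    rw [map_mul, coe_mul_balTakeuchi, galois_balMul hB _ hy.1, hx.1, hB.comul_mul,
      translationLift_takMul hred _ hx.2, hy.2, actR_tmul, actB_balTmul, mul_one]
    exact ⟨rfl, rfl⟩

end Translation

/-! ### Twisted group algebras -/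

section TwistedGroupAlgebra

open Coalgebra SkewMonoidAlgebra

section Coalgebra

variable {R G : Type*} [CommRing R]

theorem comul_single (g : G) (r : R) :
    comul (R := R) (single g r : SkewMonoidAlgebra R G) = r • (single g 1 ⊗ₜ[R] single g 1) :=
  twistedLift_single _ g r

theorem counit_single (g : G) (r : R) :
    counit (R := R) (single g r : SkewMonoidAlgebra R G) = r :=
  (twistedLift_single _ g r).trans (mul_one r)

end Coalgebra

variable (k R G : Type*) [Field k] [CommRing R] [Algebra k R] [Group G] [MulSemiringAction G R]
  [SMulCommClass G k R]

theorem incl_twisted (r : R) : incl R (SkewMonoidAlgebra R G) r = single 1 r := by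
  rw [incl_apply, one_def, SkewMonoidAlgebra.smul_single, smul_eq_mul, mul_one]

variable {R G}

theorem single_mul_incl (g : G) (r : R) :
    (single g 1 : SkewMonoidAlgebra R G) * incl R _ r = (g • r) • single g 1 := by
  rw [incl_twisted, single_mul_single, SkewMonoidAlgebra.smul_single, mul_one, one_mul,
    smul_eq_mul, mul_one]

variable (R G)

theorem adjoin_incl_union_single : Algebra.adjoin k (Set.range (incl R (SkewMonoidAlgebra R G)) ∪
    Set.range fun g : G => single g 1) = ⊤ := by
  refine Algebra.eq_top_iff.2 fun h => ?_
  induction h using SkewMonoidAlgebra.induction_on with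
  | zero => exact zero_mem _
  | single g r =>
    have single_eq : (single g r : SkewMonoidAlgebra R G) = incl R _ r * single g 1 := by
      rw [incl_mul, SkewMonoidAlgebra.smul_single, smul_eq_mul, mul_one]
    rw [single_eq]
    exact mul_mem (Algebra.subset_adjoin (.inl ⟨r, rfl⟩)) (Algebra.subset_adjoin (.inr ⟨g, rfl⟩))
  | add x y hx hy => exact add_mem hx hy

/-- The group-like elements `g ⊗ g` of the Takeuchi product. -/
def groupTakeuchi : G →* takeuchi R (SkewMonoidAlgebra R G) where
  toFun g := ⟨single g 1 ⊗ₜ[R] single g 1, fun r => by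
    rw [actR_tmul, actR_tmul, single_mul_incl, mul_one, TensorProduct.smul_tmul]⟩
  map_one' := rfl
  map_mul' g g' := Subtype.ext <| by
    simp [coe_mul_takeuchi, single_mul_single]

/-- The elements `g ⊠ g⁻¹` of the Takeuchi product with the opposite algebra. -/
def groupBalTakeuchi : G →* balTakeuchi R (SkewMonoidAlgebra R G) where
  toFun g := ⟨balTmul R _ (single g 1) (single g⁻¹ 1), fun r => by
    have incl_mul_single : incl R (SkewMonoidAlgebra R G) r * single g 1 =
        single g 1 * incl R _ (g⁻¹ • r) := by
      rw [single_mul_incl, smul_inv_smul, incl_mul]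
    rw [actB_balTmul, actB_balTmul, incl_mul_single, balTmul_balanced, mul_one, one_mul,
      single_mul_incl]⟩
  map_one' := Subtype.ext (by simp only [inv_one]; rfl)
  map_mul' g g' := Subtype.ext <| by
    simp [coe_mul_balTakeuchi, single_mul_single]

/-- The comultiplication of the twisted group algebra, as an algebra morphism to the Takeuchi
product. -/
def twistedComul : SkewMonoidAlgebra R G →ₐ[k] takeuchi R (SkewMonoidAlgebra R G) :=
  liftNCAlgHom (inclTakeuchi k R _) (groupTakeuchi R G) fun {r g} => Subtype.ext <| by
    rw [coe_inclTakeuchi_mul, coe_mul_inclTakeuchi]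
    change _ = actR R _ _ _ (single g 1 ⊗ₜ[R] single g 1)
    rw [actR_tmul, single_mul_incl, mul_one, ← TensorProduct.smul_tmul']
    rfl

/-- The representation of the twisted group algebra on `R`. -/
def twistedRep : SkewMonoidAlgebra R G →ₐ[k] Module.End k R :=
  liftNCAlgHom (Algebra.lmul k R) (DistribMulAction.toModuleEnd k R) fun {x y} =>
    LinearMap.ext fun f => by simp [smul_mul']

/-- The translation map `r g ↦ r g ⊠ g⁻¹` of the twisted group algebra. -/
def twistedRed : SkewMonoidAlgebra R G →ₐ[k] balTakeuchi R (SkewMonoidAlgebra R G) :=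
  liftNCAlgHom (inclBalTakeuchi k R _) (groupBalTakeuchi R G) fun {r g} => Subtype.ext <| by
    rw [coe_inclBalTakeuchi_mul, coe_mul_balTakeuchi]
    change actB R _ _ _ (balTmul R _ (single g 1) _) = balMul _ _ (balTmul R _ (single g 1) _)
    rw [balMul_balTmul, coe_inclBalTakeuchi, actB_balTmul, actB_balTmul, single_mul_incl, incl_mul,
      mul_one, one_mul]

variable {k R G}

theorem coe_twistedComul (h : SkewMonoidAlgebra R G) :
    (twistedComul k R G h).1 = comul (R := R) h := by
  induction h using SkewMonoidAlgebra.induction_on with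
  | zero => rw [map_zero, map_zero, ZeroMemClass.coe_zero]
  | single g r =>
    rw [comul_single]
    refine (congrArg Subtype.val (liftNC_single _ _ g r)).trans ?_
    exact coe_inclTakeuchi_mul (k := k) r (groupTakeuchi R G g)
  | add x y hx hy => rw [map_add, AddSubgroup.coe_add, map_add, hx, hy]

theorem twistedRep_single (g : G) (r f : R) :
    twistedRep k R G (single g r) f = r * g • f := by
  simp [twistedRep, liftNCAlgHom, liftNCRingHom]

theorem coe_twistedRed_incl (r : R) : (twistedRed k R G (incl R _ r)).1 =
    balTmul R (SkewMonoidAlgebra R G) (incl R _ r) 1 := by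
  rw [← coe_inclBalTakeuchi (k := k), incl_twisted]
  refine congrArg Subtype.val ((liftNC_single _ _ 1 r).trans ?_)
  rw [map_one, mul_one]
  rfl

theorem coe_twistedRed_single (g : G) : (twistedRed k R G (single g 1)).1 =
    balTmul R (SkewMonoidAlgebra R G) (single g 1) (single g⁻¹ 1) := by
  refine congrArg Subtype.val ((liftNC_single _ _ g 1).trans ?_ : _ = groupBalTakeuchi R G g)
  exact (congrArg (· * _) (map_one (inclBalTakeuchi k R _))).trans (one_mul _)

variable (k R G)

theorem twisted_isLeftBialgebroid : IsLeftBialgebroid k R (SkewMonoidAlgebra R G) where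
  incl_injective r r' h := by
    rw [incl_twisted, incl_twisted] at h
    exact single_injective 1 h
  comul_algHom := ⟨twistedComul k R G, coe_twistedComul⟩
  counit_rep := by
    refine ⟨twistedRep k R G, fun h r => ?_, fun r r' => ?_⟩
    · induction h using SkewMonoidAlgebra.induction_on with
      | zero => simp
      | add x x' hx hx' => rw [map_add, LinearMap.add_apply, add_mul, map_add, hx, hx']
      | single g a =>
        rw [incl_twisted, single_mul_single, counit_single, twistedRep_single]
    · rw [incl_twisted, twistedRep_single, one_smul]

theorem twisted_isHopfAlgebroid : IsHopfAlgebroid k R (SkewMonoidAlgebra R G) where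
  toIsLeftBialgebroid := twisted_isLeftBialgebroid k R G
  galois_bijective := by
    have key := galois_translation_of_adjoin (coe_twistedRed_incl (k := k))
      (twisted_isLeftBialgebroid k R G) (adjoin_incl_union_single k R G)
    refine galois_bijective_of_translation coe_twistedRed_incl _ (fun h => (key ?_ ?_ h).1)
      fun h => (key ?_ ?_ h).2
    all_goals rintro _ ⟨g, rfl⟩
    all_goals simp only [comul_single, one_smul, translationLift_tmul, coe_twistedRed_single,
      galois_balTmul, actR_tmul, actB_balTmul, single_mul_single, smul_one, mul_one, one_mul,
      mul_inv_cancel, inv_mul_cancel, ← one_def]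

end TwistedGroupAlgebra

/-! ### Separation by linear functionals -/

section Separation

variable {R N ι κ F G : Type*} [CommRing R] [AddCommGroup N] [Module R N]

/-- The linear functional `x ⊗ y ↦ e(x) e'(y)`. -/
def tensorEval (e e' : N →ₗ[R] R) : N ⊗[R] N →ₗ[R] R :=
  TensorProduct.lid R R ∘ₗ TensorProduct.map e e'

@[simp] theorem tensorEval_tmul (e e' : N →ₗ[R] R) (x y : N) :
    tensorEval e e' (x ⊗ₜ[R] y) = e x * e' y := rfl

theorem linearIndependent_mul {x : ι → F → R} {y : κ → G → R} (hx : LinearIndependent R x)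
    (hy : LinearIndependent R y) :
    LinearIndependent R fun (p : ι × κ) (q : F × G) => x p.1 q.1 * y p.2 q.2 := by
  refine linearIndependent_iff.2 fun c hc => ?_
  have sum_eq_zero (f : F) (g : G) :
      (c.curry.sum fun i d => Finsupp.linearCombination R (y · g) d * x i f) = 0 := by
    calc (c.curry.sum fun i d => Finsupp.linearCombination R (y · g) d * x i f)
      _ = c.curry.sum fun i d => d.sum fun j r => r * (x i f * y j g) := by
        simp only [Finsupp.linearCombination_apply, Finsupp.sum_mul, smul_eq_mul, mul_assoc,
          mul_comm (x _ f)]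
      _ = Finsupp.linearCombination R (fun (p : ι × κ) (q : F × G) => x p.1 q.1 * y p.2 q.2) c
          (f, g) := by
        rw [Finsupp.sum_curry_index c fun i j r => r * (x i f * y j g),
          Finsupp.linearCombination_apply, Finsupp.sum_apply']
        rfl
      _ = 0 := congrFun hc (f, g)
  have slice_eq_zero (g : G) :
      c.curry.mapRange _ (map_zero (Finsupp.linearCombination R (y · g))) = 0 := by
    refine linearIndependent_iff.1 hx _ (funext fun f => ?_)
    rw [Finsupp.linearCombination_apply, Finsupp.sum_mapRange_index (by simp), Finsupp.sum_apply']
    exact sum_eq_zero f g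
  have curry_eq_zero : c.curry = 0 := Finsupp.ext fun i =>
    linearIndependent_iff.1 hy _ <| funext fun g => by
      have := DFunLike.congr_fun (slice_eq_zero g) i
      rw [Finsupp.mapRange_apply, Finsupp.linearCombination_apply] at this
      rw [Finsupp.linearCombination_apply, Finsupp.sum_apply']
      exact this
  ext ⟨i, j⟩
  rw [← Finsupp.curry_apply, curry_eq_zero]
  rfl

theorem eq_zero_of_mem_span_of_forall_eq_zero {v : ι → N} {e : F → N →ₗ[R] R}
    (hv : LinearIndependent R fun i f => e f (v i)) {z : N}
    (hz : z ∈ Submodule.span R (Set.range v)) (h : ∀ f, e f z = 0) : z = 0 :=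
  Submodule.disjoint_def.1
    (Submodule.range_ker_disjoint (f := LinearMap.pi e) hv) z hz (funext h)

theorem linearIndependent_of_triangular {ι α S : Type*} [LinearOrder α] [Ring S] [NoZeroDivisors S]
    (ℓ : ι → α) {f : ι → ι →₀ S}
    (hf : ∀ i, ∃ c ≠ 0, f i - Finsupp.single i c ∈ Finsupp.supported S S {j | ℓ j < ℓ i}) :
    LinearIndependent S f := by
  classical
  choose c hc hfc using hf
  have apply_eq {i j : ι} (hij : ℓ i ≤ ℓ j) : f i j = Finsupp.single i (c i) j :=
    sub_eq_zero.1 ((Finsupp.mem_supported' S _).1 (hfc i) j hij.not_gt)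
  refine linearIndependent_iff.2 fun a ha => ?_
  by_contra hne
  obtain ⟨j, hj, hmax⟩ := a.support.exists_max_image ℓ (Finsupp.support_nonempty_iff.2 hne)
  have apply_sum : ∑ i ∈ a.support, a i * f i j = 0 := by
    simpa only [Finsupp.linearCombination_apply, Finsupp.sum, Finsupp.finsetSum_apply,
      Finsupp.smul_apply, smul_eq_mul, Finsupp.zero_apply] using DFunLike.congr_fun ha j
  rw [Finset.sum_eq_single_of_mem j hj fun i hi hij => by
    rw [apply_eq (hmax i hi), Finsupp.single_eq_of_ne hij.symm, mul_zero],
    apply_eq le_rfl, Finsupp.single_eq_same] at apply_sum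
  exact mul_ne_zero (Finsupp.mem_support_iff.1 hj) (hc j) apply_sum

end Separation

end HopfAlgebroid

/-! ### Skew derivations and connections -/

/-- An additive map `D` on a commutative ring which is a derivation up to the twist
`f ↦ f - α D f`, where `α` is the root. A divided difference `f ↦ (f - s f) / α` is of this form,
with twist `s`. -/
structure SkewDerivation (R : Type*) [CommRing R] extends R →+ R where
  root : R
  leibniz (f g : R) : toFun (f * g) = toFun f * g + (f - root * toFun f) * toFun g

namespace SkewDerivation

variable {R : Type*} [CommRing R] (D : SkewDerivation R)
  (N : Type*) [AddCommGroup N] [Module R N]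

/-- An additive operator on an `R`-module which satisfies the Leibniz rule over the skew derivation
`D` of `R`. -/
structure Connection extends N →+ N where
  leibniz (r : R) (n : N) :
    toFun (r • n) = D.toFun r • n + (r - D.root * D.toFun r) • toFun n

end SkewDerivation

namespace SkewDerivation.Connection

variable {R : Type*} [CommRing R] {D : SkewDerivation R}
  {N N' N'' P P' : Type*} [AddCommGroup N] [Module R N] [AddCommGroup N'] [Module R N']
  [AddCommGroup N''] [Module R N''] [AddCommGroup P] [Module R P] [AddCommGroup P'] [Module R P']

instance : FunLike (D.Connection N) N N where
  coe d := d.toFun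
  coe_injective d d' h := by
    cases d; cases d'; congr; exact DFunLike.coe_injective h

instance : AddMonoidHomClass (D.Connection N) N N where
  map_add d := d.map_add'
  map_zero d := d.map_zero'

theorem apply_smul (d : D.Connection N) (r : R) (n : N) :
    d (r • n) = D.toFun r • n + (r - D.root * D.toFun r) • d n := d.leibniz r n

/-- The operator `n ↦ n - α d(n)`, the reflection which belongs to a connection. -/
def twist (d : D.Connection N) (n : N) : N := n - D.root • d n

theorem apply_smul' (d : D.Connection N) (r : R) (n : N) :
    d (r • n) = r • d n + D.toFun r • d.twist n := by
  rw [apply_smul, twist]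
  module

theorem twist_smul (d : D.Connection N) (r : R) (n : N) :
    d.twist (r • n) = (r - D.root * D.toFun r) • d.twist n := by
  rw [twist, twist, apply_smul]
  module

theorem twist_sub (d : D.Connection N) (n n' : N) : d.twist (n - n') = d.twist n - d.twist n' := by
  rw [twist, twist, twist, map_sub]
  module

variable (D) in
/-- The connection `D` on the unit object `R`. -/
def unit : D.Connection R where
  toAddMonoidHom := D.toAddMonoidHom
  leibniz := D.leibniz

theorem unit_apply (r : R) : unit D r = D.toFun r := rfl

/-- The operator `n ⊗ n' ↦ d(n) ⊗ n' + s(n) ⊗ d'(n')`, where `s` is the twist of `d`. -/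
def tensorHom (d : D.Connection N) (d' : D.Connection N') : N ⊗[R] N' →+ N ⊗[R] N' :=
  TensorProduct.liftAddHom
    (AddMonoidHom.mk' (fun n => AddMonoidHom.mk' (fun n' => d n ⊗ₜ[R] n' + d.twist n ⊗ₜ[R] d' n')
        fun n' n'' => by simp only [map_add, TensorProduct.tmul_add]; abel)
      fun n m => AddMonoidHom.ext fun n' => by
        simp only [AddMonoidHom.mk'_apply, AddMonoidHom.add_apply, twist, map_add, smul_add,
          TensorProduct.add_tmul, TensorProduct.sub_tmul]
        abel)
    fun r n n' => by
      change d (r • n) ⊗ₜ[R] n' + d.twist (r • n) ⊗ₜ[R] d' n' =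
        d n ⊗ₜ[R] (r • n') + d.twist n ⊗ₜ[R] d' (r • n')
      rw [apply_smul' d, twist_smul, apply_smul d']
      simp only [TensorProduct.tmul_add, TensorProduct.add_tmul, TensorProduct.tmul_smul,
        TensorProduct.smul_tmul']
      abel

/-- The connection `n ⊗ n' ↦ d(n) ⊗ n' + s(n) ⊗ d'(n')` on the tensor product, where `s` is the
twist of `d`. -/
def tensor (d : D.Connection N) (d' : D.Connection N') : D.Connection (N ⊗[R] N') where
  toAddMonoidHom := tensorHom d d'
  leibniz r z := by
    change tensorHom d d' (r • z) =
      D.toFun r • z + (r - D.root * D.toFun r) • tensorHom d d' z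
    induction z with
    | zero => simp only [smul_zero, map_zero, add_zero]
    | add y z hy hz => simp only [smul_add, map_add, hy, hz]; abel
    | tmul n n' =>
      change d (r • n) ⊗ₜ[R] n' + d.twist (r • n) ⊗ₜ[R] d' n' = D.toFun r • n ⊗ₜ[R] n' +
        (r - D.root * D.toFun r) • (d n ⊗ₜ[R] n' + d.twist n ⊗ₜ[R] d' n')
      rw [apply_smul d, twist_smul]
      simp only [TensorProduct.add_tmul, TensorProduct.smul_tmul', smul_add]
      abel

theorem tensor_tmul (d : D.Connection N) (d' : D.Connection N') (n : N) (n' : N') :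
    d.tensor d' (n ⊗ₜ[R] n') = d n ⊗ₜ[R] n' + d.twist n ⊗ₜ[R] d' n' := rfl

theorem tensor_tmul' (d : D.Connection N) (d' : D.Connection N') (n : N) (n' : N') :
    d.tensor d' (n ⊗ₜ[R] n') = d n ⊗ₜ[R] d'.twist n' + n ⊗ₜ[R] d' n' := by
  rw [tensor_tmul, twist, twist]
  simp only [TensorProduct.sub_tmul, TensorProduct.tmul_sub, TensorProduct.tmul_smul,
    TensorProduct.smul_tmul']
  abel

theorem twist_tensor_tmul (d : D.Connection N) (d' : D.Connection N') (n : N) (n' : N') :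
    (d.tensor d').twist (n ⊗ₜ[R] n') = d.twist n ⊗ₜ[R] d'.twist n' := by
  rw [twist, tensor_tmul, twist, twist]
  simp only [TensorProduct.sub_tmul, TensorProduct.tmul_sub, TensorProduct.tmul_smul,
    TensorProduct.smul_tmul', smul_add]
  abel

/-- The linear map `φ` commutes with the connections on its domain and codomain. -/
def Intertwines (d : D.Connection N) (d' : D.Connection N') (φ : N →ₗ[R] N') : Prop :=
  ∀ n, φ (d n) = d' (φ n)

variable {d : D.Connection N} {d' : D.Connection N'} {d'' : D.Connection N''} {e : D.Connection P}
  {e' : D.Connection P'}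

namespace Intertwines

theorem comp {ψ : N' →ₗ[R] N''} {φ : N →ₗ[R] N'} (hψ : Intertwines d' d'' ψ)
    (hφ : Intertwines d d' φ) : Intertwines d d'' (ψ ∘ₗ φ) := fun n => by
  rw [LinearMap.comp_apply, hφ, hψ, LinearMap.comp_apply]

theorem map_twist {φ : N →ₗ[R] N'} (hφ : Intertwines d d' φ) (n : N) :
    φ (d.twist n) = d'.twist (φ n) := by
  rw [twist, twist, map_sub, map_smul, hφ]

theorem tensor_of_tmul {Q : Type*} [AddCommGroup Q] [Module R Q] {c : D.Connection Q}
    {φ : N ⊗[R] N' →ₗ[R] Q}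
    (h : ∀ n n', φ (d n ⊗ₜ n' + d.twist n ⊗ₜ d' n') = c (φ (n ⊗ₜ n'))) :
    Intertwines (d.tensor d') c φ := fun z => by
  induction z with
  | zero => simp only [map_zero]
  | add y z hy hz => simp only [map_add, hy, hz]
  | tmul n n' => rw [tensor_tmul, h]

theorem map {φ : N →ₗ[R] P} {φ' : N' →ₗ[R] P'} (hφ : Intertwines d e φ)
    (hφ' : Intertwines d' e' φ') :
    Intertwines (d.tensor d') (e.tensor e') (TensorProduct.map φ φ') :=
  tensor_of_tmul fun n n' => by
    simp only [map_add, TensorProduct.map_tmul, tensor_tmul, hφ n, hφ.map_twist, hφ' n']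

theorem assoc : Intertwines ((d.tensor d').tensor d'') (d.tensor (d'.tensor d''))
    (TensorProduct.assoc R N N' N'').toLinearMap := fun z => by
  induction z with
  | zero => simp only [map_zero]
  | add y z hy hz => simp only [map_add, hy, hz]
  | tmul z n'' =>
    induction z with
    | zero => simp only [TensorProduct.zero_tmul, map_zero]
    | add y z hy hz => simp only [TensorProduct.add_tmul, map_add, hy, hz]
    | tmul n n' =>
      simp only [tensor_tmul, twist_tensor_tmul, LinearEquiv.coe_coe, TensorProduct.add_tmul,
        TensorProduct.tmul_add, map_add, TensorProduct.assoc_tmul, add_assoc]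

theorem comm : Intertwines (d.tensor d') (d'.tensor d) (TensorProduct.comm R N N').toLinearMap :=
  tensor_of_tmul fun n n' => by
    simp only [map_add, LinearEquiv.coe_coe, TensorProduct.comm_tmul, tensor_tmul']
    abel

theorem id : Intertwines d d LinearMap.id := fun _ => rfl

theorem lid : Intertwines ((unit D).tensor d) d (TensorProduct.lid R N).toLinearMap :=
  tensor_of_tmul fun r n => by
    simp only [map_add, LinearEquiv.coe_coe, TensorProduct.lid_tmul, twist, unit_apply, apply_smul,
      smul_eq_mul]

theorem tensorEval {f f' : N →ₗ[R] R} (hf : Intertwines d (unit D) f)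
    (hf' : Intertwines d (unit D) f') :
    Intertwines (d.tensor d) (unit D) (HopfAlgebroid.tensorEval f f') :=
  (lid (d := unit D)).comp (hf.map hf')

end Intertwines

theorem apply_mem_of_mem_span {X : Set N} {q : Submodule R N} (hXq : X ⊆ q) (hX : ∀ x ∈ X, d x ∈ q)
    {n : N} (hn : n ∈ Submodule.span R X) : d n ∈ q := by
  induction hn using Submodule.span_induction with
  | mem x hx => exact hX x hx
  | zero => simp only [map_zero, Submodule.zero_mem]
  | add x y _ _ hx hy => simpa only [map_add] using add_mem hx hy
  | smul r x hx hdx =>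
    rw [apply_smul]
    exact add_mem (q.smul_mem _ (Submodule.span_le.2 hXq hx)) (q.smul_mem _ hdx)

theorem tensor_mem_map₂_mk {p : Submodule R N} {q : Submodule R N'} (hp : ∀ n ∈ p, d n ∈ p)
    (hq : ∀ n ∈ q, d' n ∈ q) {z : N ⊗[R] N'}
    (hz : z ∈ Submodule.map₂ (TensorProduct.mk R N N') p q) :
    d.tensor d' z ∈ Submodule.map₂ (TensorProduct.mk R N N') p q := by
  rw [Submodule.map₂_eq_span_image2] at hz ⊢
  refine apply_mem_of_mem_span Submodule.subset_span ?_ hz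
  rintro _ ⟨n, hn, n', hn', rfl⟩
  rw [← Submodule.map₂_eq_span_image2]
  exact add_mem (Submodule.apply_mem_map₂ _ (hp n hn) hn')
    (Submodule.apply_mem_map₂ _ (sub_mem hn (p.smul_mem _ (hp n hn))) (hq n' hn'))

section Free

variable {ι : Type*} (D) (v : ι → ι →₀ R)

/-- The connection on a free module with given values on the basis vectors. -/
def free : D.Connection (ι →₀ R) where
  toAddMonoidHom := Finsupp.liftAddHom fun i => AddMonoidHom.mk'
    (fun r => Finsupp.single i (D.toFun r) + (r - D.root * D.toFun r) • v i) fun r r' => by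
      rw [show D.toFun (r + r') = D.toFun r + D.toFun r' from D.map_add' r r', Finsupp.single_add]
      module
  leibniz r n := by
    change Finsupp.liftAddHom _ (r • n) = D.toFun r • n + _ • Finsupp.liftAddHom _ n
    induction n using Finsupp.induction_linear with
    | zero => simp only [smul_zero, map_zero, add_zero]
    | add n n' hn hn' => simp only [smul_add, map_add, hn, hn']; abel
    | single i r' =>
      simp only [Finsupp.smul_single, Finsupp.liftAddHom_apply_single, AddMonoidHom.mk'_apply,
        smul_eq_mul, D.leibniz, Finsupp.single_add, smul_add, smul_smul]
      rw [add_assoc]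
      congr 3
      ring

variable {D}

theorem free_single (i : ι) (r : R) : free D v (Finsupp.single i r) =
    Finsupp.single i (D.toFun r) + (r - D.root * D.toFun r) • v i :=
  Finsupp.liftAddHom_apply_single _ i r

end Free

end SkewDerivation.Connection

namespace NilHecke

/-! ### Alternating words -/

section AltWord

/-- The letter in position `n`, counted from `0`, of the word in two letters which starts with `b`
and alternates. -/
def altLetter (b : Bool) (n : ℕ) : Bool := b ^^ n.bodd

theorem altLetter_zero (b : Bool) : altLetter b 0 = b := by simp [altLetter]

theorem altLetter_succ (b : Bool) (n : ℕ) : altLetter b (n + 1) = !altLetter b n := by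
  simp [altLetter, Nat.bodd_succ]

theorem altLetter_not (b : Bool) (n : ℕ) : altLetter (!b) n = !altLetter b n := by
  simp [altLetter]

variable {A : Type*} [Monoid A]

/-- The product of the first `n` letters of the alternating word which starts with `b`, where the
two letters are interpreted by `D`. -/
def altWord (D : Bool → A) (b : Bool) (n : ℕ) : A := altProd (D b) (D !b) n

variable (D : Bool → A) (b : Bool) (n k : ℕ)

theorem altWord_zero : altWord D b 0 = 1 := rfl

theorem altWord_succ : altWord D b (n + 1) = D b * altWord D (!b) n := by
  rw [altWord, altWord, Bool.not_not, altProd]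

theorem altWord_one : altWord D b 1 = D b := by
  rw [altWord_succ, altWord_zero, mul_one]

theorem altWord_add :
    altWord D b (n + k) = altWord D b n * altWord D (altLetter b n) k := by
  induction n generalizing b with
  | zero => rw [zero_add, altWord_zero, one_mul, altLetter_zero]
  | succ n ih =>
    rw [Nat.add_right_comm, altWord_succ, ih, altWord_succ, mul_assoc, altLetter_not,
      altLetter_succ]

theorem altWord_succ_right : altWord D b (n + 1) = altWord D b n * D (altLetter b n) := by
  rw [altWord_add, altWord_one]

theorem map_altWord {A' F : Type*} [Monoid A'] [FunLike F A A'] [MonoidHomClass F A A'] (φ : F) :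
    φ (altWord D b n) = altWord (fun i => φ (D i)) b n := by
  induction n generalizing b with
  | zero => rw [altWord_zero, altWord_zero, map_one]
  | succ n ih => rw [altWord_succ, altWord_succ, map_mul, ih]

end AltWord

/-! ### Braid relations -/

section Braid

variable {B A : Type*} [Monoid A] {M : CoxeterMatrix B}

/-- The braid relations of a Coxeter matrix. The two letters of a relation are given by a map `c`
from `Bool`, which allows to treat both sides uniformly. The excluded cases `m = 0`, which encodes
`m_{st} = ∞`, and `m = 1`, where the two letters agree, give no condition. -/
def IsBraided (M : CoxeterMatrix B) (d : B → A) : Prop :=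
  ∀ ⦃c : Bool → B⦄ ⦃m : ℕ⦄, (∀ b, M (c b) (c !b) = m) → 2 ≤ m → ∀ b,
    altWord (fun i => d (c i)) (!b) m = altWord (fun i => d (c i)) b m

namespace IsBraided

variable {d : B → A}

theorem of_altProd
    (h : ∀ s t, altProd (d s) (d t) (M s t) = altProd (d t) (d s) (M s t)) : IsBraided M d :=
  fun c m hc _ b => by
    rw [altWord, altWord, Bool.not_not, ← hc b, ← h]

theorem altProd_comm (h : IsBraided M d) (s t : B) :
    altProd (d s) (d t) (M s t) = altProd (d t) (d s) (M s t) := by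
  by_cases hst : s = t
  · rw [hst]
  rcases Nat.eq_zero_or_pos (M s t) with h0 | hpos
  · rw [h0, altProd, altProd]
  have hM : ∀ b, M (cond b s t) (cond (!b) s t) = M s t :=
    Bool.forall_bool.2 ⟨M.symmetric t s, rfl⟩
  have two_le : 2 ≤ M s t := by
    have := M.off_diagonal s t hst
    omega
  exact h hM two_le false

theorem map {A' F : Type*} [Monoid A'] [FunLike F A A'] [MonoidHomClass F A A']
    (h : IsBraided M d) (φ : F) : IsBraided M fun s => φ (d s) := fun c m hc hm b => by
  simpa only [map_altWord] using congrArg φ (h hc hm b)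

end IsBraided

open CoxeterSystem in
theorem altProd_simple {W : Type*} [Group W] (cs : CoxeterSystem M W) (s t : B) (n : ℕ) :
    altProd (cs.simple s) (cs.simple t) n = (cs.wordProd (alternatingWord t s n))⁻¹ := by
  induction n generalizing s t with
  | zero => rw [altProd, alternatingWord, cs.wordProd_nil, inv_one]
  | succ n ih =>
    rw [altProd, ih, alternatingWord_succ, List.concat_eq_append, cs.wordProd_append,
      cs.wordProd_singleton, mul_inv_rev, cs.inv_simple]

theorem isBraided_simple {W : Type*} [Group W] (cs : CoxeterSystem M W) :
    IsBraided M cs.simple := .of_altProd fun s t => by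
  have h := cs.wordProd_braidWord_eq t s
  rw [CoxeterSystem.braidWord, CoxeterSystem.braidWord, M.symmetric t s] at h
  rw [altProd_simple, altProd_simple, h]

end Braid

/-! ### Dihedral reflection groups -/

section Dihedral

section SinRatio

/-- The ratio `sin (n π / m) / sin (π / m)`, the value at `2 cos (π / m)` of a Chebyshev polynomial
of the second kind. It is the coefficient of a simple root in a root of a dihedral group. -/
def sinRatio (m n : ℕ) : ℝ := Real.sin (n * (Real.pi / m)) / Real.sin (Real.pi / m)

variable {m n : ℕ}

theorem sinRatio_zero : sinRatio m 0 = 0 := by simp [sinRatio]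

theorem sinRatio_add_two (m n : ℕ) : sinRatio m (n + 2) =
    2 * Real.cos (Real.pi / m) * sinRatio m (n + 1) - sinRatio m n := by
  have sin_add_two (θ : ℝ) : Real.sin ((n + 2 : ℕ) * θ) =
      2 * Real.cos θ * Real.sin ((n + 1 : ℕ) * θ) - Real.sin (n * θ) := by
    rw [show ((n + 2 : ℕ) : ℝ) * θ = (n + 1 : ℕ) * θ + θ by push_cast; ring,
      show (n : ℝ) * θ = (n + 1 : ℕ) * θ - θ by push_cast; ring, Real.sin_add, Real.sin_sub]
    ring
  rw [sinRatio, sin_add_two, sinRatio, sinRatio]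
  ring

theorem sinRatio_self : sinRatio m m = 0 := by
  rcases eq_or_ne m 0 with rfl | hm
  · exact sinRatio_zero
  · rw [sinRatio, mul_div_cancel₀ _ (by positivity), Real.sin_pi, zero_div]

theorem sin_pi_div_pos (hm : 2 ≤ m) : 0 < Real.sin (Real.pi / m) :=
  Real.sin_pos_of_pos_of_lt_pi (by positivity)
    (div_lt_self Real.pi_pos (by exact_mod_cast Nat.lt_of_succ_le hm))

theorem sinRatio_one (hm : 2 ≤ m) : sinRatio m 1 = 1 := by
  rw [sinRatio, Nat.cast_one, one_mul, div_self (sin_pi_div_pos hm).ne']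

theorem sinRatio_of_succ_eq (hm : 2 ≤ m) (hn : n + 1 = m) : sinRatio m n = 1 := by
  have h : (n : ℝ) * (Real.pi / m) = Real.pi - Real.pi / m := by
    rw [eq_sub_iff_add_eq, ← add_one_mul, ← Nat.cast_succ, Nat.succ_eq_add_one, hn,
      mul_div_cancel₀ _ (by positivity)]
  rw [sinRatio, h, Real.sin_pi_sub, div_self (sin_pi_div_pos hm).ne']

theorem sinRatio_pos (hm : 2 ≤ m) (hn : 0 < n) (hnm : n < m) : 0 < sinRatio m n := by
  refine div_pos (Real.sin_pos_of_pos_of_lt_pi (by positivity) ?_) (sin_pi_div_pos hm)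
  rw [mul_div_assoc', div_lt_iff₀ (by positivity), mul_comm]
  exact mul_lt_mul_of_pos_left (by exact_mod_cast hnm) Real.pi_pos

end SinRatio

variable {B : Type*} {M : CoxeterMatrix B}

theorem geomReflection_apply (s : B) (x : B →₀ ℝ) :
    geomReflection M s x = x - coroot M s x • simpleRoot s := rfl

theorem geomReflection_self (s : B) : geomReflection M s (simpleRoot s) = -simpleRoot s := by
  rw [geomReflection_apply, coroot_self]
  module

theorem geomRep_simple {W : Type*} [Group W] (cs : CoxeterSystem M W) (s : B) :
    geomRep cs (cs.simple s) = geomReflection M s :=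
  cs.lift_apply_simple (geomReflection_isLiftable M) s

theorem isBraided_geomReflection : IsBraided M (geomReflection M) := by
  have h := (isBraided_simple M.toCoxeterSystem).map (geomRep M.toCoxeterSystem)
  simpa only [geomRep_simple] using h

variable {c : Bool → B} {m : ℕ} (hc : ∀ b, M (c b) (c !b) = m)

include hc

theorem coroot_altWord (hm : 2 ≤ m) (b : Bool) (n : ℕ) (x : B →₀ ℝ) :
    coroot M (c b) (altWord (fun i => geomReflection M (c i)) (!b) n x) =
      sinRatio m (n + 1) * coroot M (c (altLetter b n)) x +
        sinRatio m n * coroot M (c !altLetter b n) x := by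
  induction n generalizing x with
  | zero =>
    rw [altWord_zero, Module.End.one_apply, sinRatio_zero, zero_add, sinRatio_one hm,
      altLetter_zero]
    ring
  | succ n ih =>
    rw [altWord_succ_right, Module.End.mul_apply, ih, altLetter_not, geomReflection_apply,
      altLetter_succ, Bool.not_not, sinRatio_add_two]
    simp only [map_sub, map_smul, smul_eq_mul, coroot_self, coroot_simpleRoot, hc]
    ring

theorem coroot_altWord_of_succ_eq (hm : 2 ≤ m) {n : ℕ} (hn : n + 1 = m) (b : Bool) (x : B →₀ ℝ) :
    coroot M (c b) (altWord (fun i => geomReflection M (c i)) (!b) n x) =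
      coroot M (c !altLetter b n) x := by
  rw [coroot_altWord hc hm, hn, sinRatio_self, sinRatio_of_succ_eq hm hn, zero_mul, zero_add,
    one_mul]

end Dihedral

/-! ### Families with the relations of the nil Hecke algebra -/

section Family

variable {B : Type*} {M : CoxeterMatrix B} {A : Type*} [Ring A] [Algebra ℝ A]

/-- The vectors `L x` and the elements `d s` of an algebra satisfy the defining relations of the
nil Hecke algebra, except for linearity, which is that of `L`, and for the braid relations. -/
structure IsNilHeckeFamily (M : CoxeterMatrix B) (L : (B →₀ ℝ) →ₗ[ℝ] A) (d : B → A) : Prop where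
  comm : ∀ x y, L x * L y = L y * L x
  twistedWeyl : ∀ s x,
    d s * L x = L (geomReflection M s x) * d s + algebraMap ℝ A (coroot M s x)
  nil : ∀ s, d s * d s = 0

variable {L : (B →₀ ℝ) →ₗ[ℝ] A} {d : B → A} (hd : IsNilHeckeFamily M L d) {c : Bool → B}

include hd

namespace IsNilHeckeFamily

theorem altWord_mul (b : Bool) (n : ℕ) (x : B →₀ ℝ) :
    altWord (fun i => d (c i)) b (n + 2) * L x =
      L (altWord (fun i => geomReflection M (c i)) b (n + 2) x) *
          altWord (fun i => d (c i)) b (n + 2)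
      + coroot M (c b) (altWord (fun i => geomReflection M (c i)) (!b) (n + 1) x) •
          altWord (fun i => d (c i)) (!b) (n + 1)
      + coroot M (c (altLetter b (n + 1))) x • altWord (fun i => d (c i)) b (n + 1) := by
  induction n generalizing b with
  | zero =>
    simp only [altWord_succ, altWord_zero, altLetter_succ, altLetter_zero, mul_one, mul_assoc,
      hd.twistedWeyl, mul_add, Module.End.mul_apply, Algebra.algebraMap_eq_smul_one,
      mul_smul_comm]
    rw [← mul_assoc, hd.twistedWeyl, add_mul, mul_assoc, Algebra.algebraMap_eq_smul_one,
      smul_mul_assoc, one_mul]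
  | succ n ih =>
    rw [altWord_succ _ _ (n + 2), mul_assoc, ih (!b), mul_add, mul_add, ← mul_assoc,
      hd.twistedWeyl, add_mul, mul_smul_comm, mul_smul_comm, Bool.not_not,
      altWord_succ (fun i => d (c i)) b n, ← mul_assoc (d _) (d _), hd.nil, zero_mul, smul_zero,
      add_zero, mul_assoc, ← Algebra.smul_def, ← Module.End.mul_apply, altLetter_not,
      ← altLetter_succ, altWord_succ _ b (n + 2),
      altWord_succ _ b (n + 1)]

variable {m : ℕ} (hc : ∀ b, M (c b) (c !b) = m) (hm : 2 ≤ m)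

include hc hm

theorem altWord_sub_mul (b : Bool) (x : B →₀ ℝ) :
    (altWord (fun i => d (c i)) b m - altWord (fun i => d (c i)) (!b) m) * L x =
      L (altWord (fun i => geomReflection M (c i)) b m x) *
        (altWord (fun i => d (c i)) b m - altWord (fun i => d (c i)) (!b) m) := by
  obtain ⟨n, rfl⟩ : ∃ n, m = n + 2 := ⟨m - 2, by omega⟩
  rw [sub_mul, hd.altWord_mul, hd.altWord_mul, coroot_altWord_of_succ_eq hc hm rfl,
    coroot_altWord_of_succ_eq hc hm rfl, isBraided_geomReflection hc hm, altLetter_not,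
    Bool.not_not, Bool.not_not, mul_sub]
  abel

theorem altWord_ne_zero [Nontrivial A] (b : Bool) {n : ℕ} (hn : n ≤ m) :
    altWord (fun i => d (c i)) b n ≠ 0 := by
  have smul_one_ne_zero {r : ℝ} (hr : 0 < r) : r • (1 : A) ≠ 0 := smul_ne_zero hr.ne' one_ne_zero
  induction n generalizing b with
  | zero => exact one_ne_zero
  | succ n ih =>
    intro h
    rcases n with _ | n
    · have h' := hd.twistedWeyl (c b) (simpleRoot (c b))
      rw [altWord_one] at h
      rw [h, zero_mul, mul_zero, zero_add, coroot_self, Algebra.algebraMap_eq_smul_one] at h'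
      exact smul_one_ne_zero two_pos h'.symm
    · set θ := Real.pi / (m : ℝ)
      -- the vector orthogonal to the last root of the word leaves only one term in `altWord_mul`
      set a := altLetter b (n + 1)
      set x := simpleRoot (c !a) + Real.cos θ • simpleRoot (c a) with hx
      have coroot_last : coroot M (c a) x = 0 := by
        rw [hx, map_add, map_smul, coroot_self, coroot_simpleRoot, hc, smul_eq_mul]
        ring
      have coroot_other : coroot M (c !a) x = 2 * Real.sin θ ^ 2 := by
        have := hc (!a)
        rw [Bool.not_not] at this
        rw [hx, map_add, map_smul, coroot_self, coroot_simpleRoot, this, smul_eq_mul, Real.sin_sq]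
        ring
      have coroot_pos : 0 < sinRatio m (n + 1) * (2 * Real.sin θ ^ 2) := by
        have := sinRatio_pos hm n.succ_pos (by omega)
        have := sin_pi_div_pos hm
        positivity
      have h' := hd.altWord_mul (c := c) b n x
      rw [h, zero_mul, mul_zero, zero_add, coroot_altWord hc hm, coroot_last, mul_zero, zero_add,
        coroot_other, zero_smul, add_zero] at h'
      exact smul_ne_zero coroot_pos.ne' (ih (!b) (by omega)) h'.symm

end IsNilHeckeFamily

end Family

section Opposite

open MulOpposite

theorem altLetter_altLetter (b : Bool) (n : ℕ) : altLetter (altLetter b n) n = b := by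
  simp [altLetter]

theorem altWord_op {A : Type*} [Monoid A] (D : Bool → A) (b : Bool) (n : ℕ) :
    altWord (fun i => op (D i)) b n = op (altWord D (!altLetter b n) n) := by
  induction n generalizing b with
  | zero => rw [altWord_zero, altWord_zero, op_one]
  | succ n ih =>
    rw [altWord_succ, ih, altLetter_succ, altLetter_not, Bool.not_not, altWord_succ_right,
      altLetter_altLetter, op_mul]

variable {B : Type*} {M : CoxeterMatrix B}

theorem IsBraided.op {A : Type*} [Monoid A] {d : B → A} (hb : IsBraided M d) :
    IsBraided M fun s => MulOpposite.op (d s) := fun c m hc hm b => by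
  rw [altWord_op, altWord_op, altLetter_not, Bool.not_not, hb hc hm]

theorem coroot_geomReflection (s : B) (x : B →₀ ℝ) :
    coroot M s (geomReflection M s x) = -coroot M s x := by
  rw [geomReflection_apply, map_sub, map_smul, coroot_self, smul_eq_mul]
  ring

theorem geomReflection_geomReflection (s : B) (x : B →₀ ℝ) :
    geomReflection M s (geomReflection M s x) = x := by
  rw [geomReflection_apply s (geomReflection M s x), coroot_geomReflection, geomReflection_apply]
  module

theorem IsNilHeckeFamily.op {A : Type*} [Ring A] [Algebra ℝ A] {L : (B →₀ ℝ) →ₗ[ℝ] A} {d : B → A}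
    (hd : IsNilHeckeFamily M L d) :
    IsNilHeckeFamily M ((opLinearEquiv ℝ).toLinearMap ∘ₗ L) fun s => MulOpposite.op (d s) where
  comm x y := congrArg MulOpposite.op (hd.comm y x)
  twistedWeyl s x := congrArg MulOpposite.op <|
    show L x * d s = d s * L (geomReflection M s x) + algebraMap ℝ A (coroot M s x) by
      rw [hd.twistedWeyl, geomReflection_geomReflection, coroot_geomReflection, map_neg,
        neg_add_cancel_right]
  nil s := congrArg MulOpposite.op (hd.nil s)

end Opposite

/-! ### Demazure operators -/

section Demazure

variable {B W : Type*} [Group W] {M : CoxeterMatrix B} (cs : CoxeterSystem M W)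

instance : IsDomain (SymRing cs) := inferInstanceAs (IsDomain (SymmetricAlgebra ℝ (B →₀ ℝ)))

variable {cs} in
@[elab_as_elim]
theorem sym_induction {p : SymRing cs → Prop} (f : SymRing cs)
    (algebraMap : ∀ c : ℝ, p (algebraMap ℝ _ c)) (ι : ∀ x, p (symι cs x))
    (mul : ∀ f g, p f → p g → p (f * g)) (add : ∀ f g, p f → p g → p (f + g)) : p f :=
  SymmetricAlgebra.induction (R := ℝ) (M := B →₀ ℝ) (motive := p) algebraMap ι mul add f

theorem simple_smul_ι (s : B) (x : B →₀ ℝ) :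
    cs.simple s • symι cs x = symι cs (geomReflection M s x) := by
  rw [← geomRep_simple cs]
  exact symAct_ι cs _ x

/-- The simple root `α_s` as an element of `R`. -/
def symRoot (s : B) : SymRing cs := symι cs (simpleRoot s)

theorem symRoot_ne_zero (s : B) : symRoot cs s ≠ 0 := by
  let coroot_lift : SymRing cs →ₐ[ℝ] ℝ := SymmetricAlgebra.lift (coroot M s)
  have lift_symRoot : coroot_lift (symRoot cs s) = 2 :=
    (SymmetricAlgebra.lift_ι_apply (coroot M s) (simpleRoot s)).trans (coroot_self M s)
  intro h
  rw [h, map_zero] at lift_symRoot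
  exact two_ne_zero lift_symRoot.symm

theorem simple_smul_symRoot (s : B) : cs.simple s • symRoot cs s = -symRoot cs s := by
  rw [symRoot, simple_smul_ι, geomReflection_self, map_neg]

theorem symι_geomReflection (s : B) (x : B →₀ ℝ) :
    symι cs (geomReflection M s x) = symι cs x - coroot M s x • symRoot cs s := by
  rw [geomReflection_apply, map_sub, map_smul, symRoot]

theorem symRoot_dvd_sub_smul (s : B) (f : SymRing cs) :
    symRoot cs s ∣ f - cs.simple s • f := by
  let mod_root := Ideal.Quotient.mkₐ ℝ (Ideal.span {symRoot cs s})
  have reflection_trivial : mod_root = mod_root.comp (symAct cs (cs.simple s)) :=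
    sym_hom_ext cs fun x => by
      refine Ideal.Quotient.eq.2 (Ideal.mem_span_singleton'.2 ⟨algebraMap ℝ _ (coroot M s x), ?_⟩)
      change _ = symι cs x - cs.simple s • symι cs x
      rw [simple_smul_ι, symι_geomReflection, sub_sub_cancel, Algebra.smul_def]
  exact Ideal.mem_span_singleton.1 (Ideal.Quotient.eq.1 (DFunLike.congr_fun reflection_trivial f))

/-- The Demazure operator `f ↦ (f - s f) / α_s`. -/
def demazure (s : B) : Module.End ℝ (SymRing cs) where
  toFun f := (symRoot_dvd_sub_smul cs s f).choose
  map_add' f g := mul_left_cancel₀ (symRoot_ne_zero cs s) (by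
    rw [mul_add, ← (symRoot_dvd_sub_smul cs s _).choose_spec,
      ← (symRoot_dvd_sub_smul cs s _).choose_spec,
      ← (symRoot_dvd_sub_smul cs s _).choose_spec, smul_add]
    ring)
  map_smul' c f := mul_left_cancel₀ (symRoot_ne_zero cs s) (by
    rw [RingHom.id_apply, mul_smul_comm, ← (symRoot_dvd_sub_smul cs s _).choose_spec,
      ← (symRoot_dvd_sub_smul cs s _).choose_spec, smul_sub, smul_comm])

theorem symRoot_mul_demazure (s : B) (f : SymRing cs) :
    symRoot cs s * demazure cs s f = f - cs.simple s • f :=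
  (symRoot_dvd_sub_smul cs s f).choose_spec.symm

theorem sub_symRoot_mul_demazure (s : B) (f : SymRing cs) :
    f - symRoot cs s * demazure cs s f = cs.simple s • f := by
  rw [symRoot_mul_demazure, sub_sub_cancel]

variable {cs}

theorem demazure_eq {s : B} {f g : SymRing cs} (h : symRoot cs s * g = f - cs.simple s • f) :
    demazure cs s f = g :=
  mul_left_cancel₀ (symRoot_ne_zero cs s) ((symRoot_mul_demazure cs s f).trans h.symm)

theorem demazure_eq_zero {s : B} {f : SymRing cs} (h : cs.simple s • f = f) :
    demazure cs s f = 0 :=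
  demazure_eq (by rw [h, sub_self, mul_zero])

theorem demazure_algebraMap (s : B) (c : ℝ) : demazure cs s (algebraMap ℝ _ c) = 0 :=
  demazure_eq_zero ((symAct cs (cs.simple s)).commutes c)

theorem demazure_ι (s : B) (x : B →₀ ℝ) :
    demazure cs s (symι cs x) = algebraMap ℝ _ (coroot M s x) :=
  demazure_eq (by
    rw [simple_smul_ι, symι_geomReflection, sub_sub_cancel, mul_comm, Algebra.smul_def])

theorem demazure_mul (s : B) (f g : SymRing cs) :
    demazure cs s (f * g) = demazure cs s f * g + cs.simple s • f * demazure cs s g :=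
  demazure_eq (by
    rw [smul_mul']
    linear_combination g * symRoot_mul_demazure cs s f +
      cs.simple s • f * symRoot_mul_demazure cs s g)

theorem simple_smul_simple_smul (s : B) (f : SymRing cs) :
    cs.simple s • cs.simple s • f = f := by
  rw [smul_smul, cs.simple_mul_simple_self, one_smul]

theorem smul_demazure (s : B) (f : SymRing cs) : cs.simple s • demazure cs s f = demazure cs s f :=
  (demazure_eq (by
    have h := congrArg (cs.simple s • ·) (symRoot_mul_demazure cs s f)
    simp only [smul_mul', smul_sub, simple_smul_symRoot, simple_smul_simple_smul] at h
    linear_combination -h)).symm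

theorem demazure_smul (s : B) (f : SymRing cs) :
    demazure cs s (cs.simple s • f) = -demazure cs s f :=
  demazure_eq (by
    rw [simple_smul_simple_smul]
    linear_combination -symRoot_mul_demazure cs s f)

theorem demazure_demazure (s : B) (f : SymRing cs) : demazure cs s (demazure cs s f) = 0 :=
  demazure_eq_zero (smul_demazure s f)

variable (cs) in
/-- The Demazure operator as a skew derivation, whose twist is the action of `s`. -/
def demazureSkew (s : B) : SkewDerivation (SymRing cs) where
  toAddMonoidHom := (demazure cs s).toAddMonoidHom
  root := symRoot cs s
  leibniz f g := by
    change demazure cs s (f * g) = demazure cs s f * g +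
      (f - symRoot cs s * demazure cs s f) * demazure cs s g
    rw [sub_symRoot_mul_demazure, demazure_mul]

end Demazure

/-! ### Morphisms out of the nil Hecke algebra -/

section Lift

variable {B W : Type*} [Group W] {M : CoxeterMatrix B} (cs : CoxeterSystem M W) {A : Type*} [Ring A]
  [Algebra ℝ A] {L : (B →₀ ℝ) →ₗ[ℝ] A} {d : B → A}

theorem map_altProd {A A' F : Type*} [Monoid A] [Monoid A'] [FunLike F A A']
    [MonoidHomClass F A A'] (φ : F) (a b : A) (n : ℕ) :
    φ (altProd a b n) = altProd (φ a) (φ b) n := by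
  induction n generalizing a b with
  | zero => exact map_one φ
  | succ n ih => rw [altProd, altProd, map_mul, ih]

/-- The algebra morphism from the nil Hecke algebra given by images of the generators. -/
def nhLift (hd : IsNilHeckeFamily M L d) (hb : IsBraided M d) : NilHecke cs →ₐ[ℝ] A :=
  RingQuot.liftAlgHom ℝ ⟨FreeAlgebra.lift ℝ (Sum.elim L d), by
    intro a b h
    cases h with
    | add x y => simp
    | smul c x => simp
    | comm x y => simpa using hd.comm x y
    | twistedWeyl s x => simpa using hd.twistedWeyl s x
    | nil s => simpa using hd.nil s
    | braid s t => simpa [map_altProd] using hb.altProd_comm s t⟩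

variable {cs} (hd : IsNilHeckeFamily M L d) (hb : IsBraided M d)

theorem nhLift_wt (x : B →₀ ℝ) : nhLift cs hd hb (wt cs x) = L x := by
  change RingQuot.liftAlgHom ℝ _ (RingQuot.mkAlgHom ℝ (NilHeckeRel M) (freeWt x)) = _
  rw [RingQuot.liftAlgHom_mkAlgHom_apply, FreeAlgebra.lift_ι_apply, Sum.elim_inl]

theorem nhLift_del (s : B) : nhLift cs hd hb (del cs s) = d s := by
  change RingQuot.liftAlgHom ℝ _ (RingQuot.mkAlgHom ℝ (NilHeckeRel M) (freeDel s)) = _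
  rw [RingQuot.liftAlgHom_mkAlgHom_apply, FreeAlgebra.lift_ι_apply, Sum.elim_inr]

@[elab_as_elim]
theorem nh_induction {p : NilHecke cs → Prop} (h : NilHecke cs) (one : p 1)
    (add : ∀ h h', p h → p h' → p (h + h')) (smul : ∀ (r : SymRing cs) h, p h → p (r • h))
    (del_mul : ∀ s h, p h → p (del cs s * h)) : p h := by
  obtain ⟨a, rfl⟩ : ∃ a, nhMk cs a = h := RingQuot.mkAlgHom_surjective ℝ (NilHeckeRel M) h
  suffices mul_right : ∀ g, p g → p (nhMk cs a * g) by simpa only [mul_one] using mul_right 1 one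
  induction a using FreeAlgebra.induction with
  | grade0 c =>
    intro g hg
    rw [AlgHom.commutes, ← Algebra.smul_def, ← algebraMap_smul (SymRing cs)]
    exact smul _ g hg
  | grade1 x =>
    rcases x with x | s
    · intro g hg
      change p (wt cs x * g)
      rw [← symIncl_ι, ← sym_smul_def]
      exact smul _ g hg
    · exact del_mul s
  | mul a b ha hb => intro g hg; rw [map_mul, mul_assoc]; exact ha _ (hb _ hg)
  | add a b ha hb => intro g hg; rw [map_add, add_mul]; exact add _ _ (ha _ hg) (hb _ hg)

end Lift

section Relations

variable {B W : Type*} [Group W] {M : CoxeterMatrix B} (cs : CoxeterSystem M W)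

theorem isNilHeckeFamily_wt_del : IsNilHeckeFamily M (wt cs) (del cs) where
  comm := wt_comm cs
  twistedWeyl s x := by
    have h := nhMk_rel cs (.twistedWeyl s x)
    rwa [map_mul, map_add, map_mul, AlgHom.commutes] at h
  nil s := by
    have h := nhMk_rel cs (.nil s)
    rwa [map_mul, map_zero] at h

theorem isBraided_del : IsBraided M (del cs) := .of_altProd fun s t => by
  have h := nhMk_rel cs (.braid s t)
  rwa [map_altProd, map_altProd] at h

theorem del_mul_sym (s : B) (r : SymRing cs) : del cs s * symIncl cs r =
    symIncl cs (cs.simple s • r) * del cs s + symIncl cs (demazure cs s r) := by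
  induction r using sym_induction with
  | algebraMap c =>
    rw [smul_algebraMap, demazure_algebraMap, map_zero, add_zero, AlgHom.commutes,
      Algebra.commutes]
  | ι x =>
    rw [simple_smul_ι, demazure_ι, symIncl_ι, symIncl_ι, AlgHom.commutes,
      (isNilHeckeFamily_wt_del cs).twistedWeyl]
  | mul f g hf hg =>
    rw [map_mul, ← mul_assoc, hf, add_mul, mul_assoc, hg, demazure_mul, smul_mul']
    simp only [map_mul, map_add]
    noncomm_ring
  | add f g hf hg =>
    rw [map_add, mul_add, hf, hg, smul_add]
    simp only [map_add]
    noncomm_ring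

/-- Left multiplication by `∂_s` as a connection over the Demazure operator. -/
def delConn (s : B) : (demazureSkew cs s).Connection (NilHecke cs) where
  toAddMonoidHom := AddMonoidHom.mulLeft (del cs s)
  leibniz r h := by
    change del cs s * (symIncl cs r * h) = symIncl cs (demazure cs s r) * h +
      symIncl cs (r - symRoot cs s * demazure cs s r) * (del cs s * h)
    rw [← mul_assoc, del_mul_sym, sub_symRoot_mul_demazure]
    noncomm_ring

theorem delConn_apply (s : B) (h : NilHecke cs) : delConn cs s h = del cs s * h := rfl

theorem delConn_delConn (s : B) (h : NilHecke cs) : delConn cs s (delConn cs s h) = 0 := by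
  rw [delConn_apply, delConn_apply, ← mul_assoc, (isNilHeckeFamily_wt_del cs).nil, zero_mul]

theorem reflElt_eq (s : B) : reflElt cs s = 1 - symRoot cs s • del cs s := by
  rw [sym_smul_def, symRoot, symIncl_ι, reflElt]

theorem delConn_twist (s : B) (h : NilHecke cs) : (delConn cs s).twist h = reflElt cs s * h := by
  rw [reflElt_eq, sub_mul, one_mul, smul_mul_assoc]
  rfl

end Relations

/-! ### Representations of the nil Hecke algebra -/

section Representation

variable {B W : Type*} [Group W] {M : CoxeterMatrix B} {cs : CoxeterSystem M W}
  {V V' : Type*} [AddCommGroup V] [Module (SymRing cs) V] [AddCommGroup V'] [Module (SymRing cs) V']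

section NilConnection

open SkewDerivation SkewDerivation.Connection

variable {s : B}

theorem twist_of_nil {d : (demazureSkew cs s).Connection V} (hd : ∀ v, d (d v) = 0) (v : V) :
    d.twist (d v) = d v := by
  rw [twist, hd, smul_zero, sub_zero]

theorem apply_twist_of_nil {d : (demazureSkew cs s).Connection V} (hd : ∀ v, d (d v) = 0) (v : V) :
    d (d.twist v) = -d v := by
  have demazure_root : demazure cs s (symRoot cs s) = 2 := by
    rw [symRoot, demazure_ι, coroot_self, map_ofNat]
  rw [twist, map_sub, d.apply_smul, hd, smul_zero, add_zero]
  change d v - demazure cs s (symRoot cs s) • d v = -d v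
  rw [demazure_root]
  module

theorem twist_twist_of_nil {d : (demazureSkew cs s).Connection V} (hd : ∀ v, d (d v) = 0) (v : V) :
    d.twist (d.twist v) = v := by
  rw [twist, apply_twist_of_nil hd, smul_neg, sub_neg_eq_add, twist, sub_add_cancel]

theorem nil_of_span {d : (demazureSkew cs s).Connection V} {X : Set V}
    (hX : Submodule.span (SymRing cs) X = ⊤) (hd : ∀ v ∈ X, d (d v) = 0) (v : V) : d (d v) = 0 := by
  have hv : v ∈ Submodule.span (SymRing cs) X := hX ▸ Submodule.mem_top
  induction hv using Submodule.span_induction with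
  | mem v hv => exact hd v hv
  | zero => rw [map_zero, map_zero]
  | add v v' _ _ hv hv' => rw [map_add, map_add, hv, hv', add_zero]
  | smul f v _ hv =>
    have apply_smul (g : SymRing cs) (v : V) :
        d (g • v) = demazure cs s g • v + (cs.simple s • g) • d v := by
      rw [← sub_symRoot_mul_demazure]
      exact d.apply_smul g v
    rw [apply_smul, map_add, apply_smul, apply_smul, demazure_demazure, smul_demazure,
      demazure_smul, hv]
    module

theorem tensor_nil {d : (demazureSkew cs s).Connection V} {d' : (demazureSkew cs s).Connection V'}
    (hd : ∀ v, d (d v) = 0) (hd' : ∀ v, d' (d' v) = 0) (z : V ⊗[SymRing cs] V') :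
    d.tensor d' (d.tensor d' z) = 0 := by
  induction z with
  | zero => simp only [map_zero]
  | add y z hy hz => simp only [map_add, hy, hz, add_zero]
  | tmul v v' =>
    simp only [tensor_tmul, map_add, hd, hd', twist_of_nil hd, apply_twist_of_nil hd,
      TensorProduct.zero_tmul, TensorProduct.tmul_zero, TensorProduct.neg_tmul, zero_add, add_zero,
      add_neg_cancel]

end NilConnection

variable [Module ℝ V] [IsScalarTower ℝ (SymRing cs) V]

/-- A connection over a Demazure operator, which is linear over the reals. -/
def connEnd {s : B} (d : (demazureSkew cs s).Connection V) : Module.End ℝ V where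
  toFun := d
  map_add' := map_add d
  map_smul' c v := by
    rw [← algebraMap_smul (SymRing cs), d.apply_smul']
    change _ + demazure cs s (algebraMap ℝ _ c) • _ = _
    rw [demazure_algebraMap, zero_smul, add_zero, algebraMap_smul, RingHom.id_apply]

theorem connEnd_apply {s : B} (d : (demazureSkew cs s).Connection V) (v : V) :
    connEnd d v = d v := rfl

variable (cs V) in
/-- The action of the vectors of the geometric representation on a module over its symmetric
algebra. -/
def wtEnd : (B →₀ ℝ) →ₗ[ℝ] Module.End ℝ V := (Algebra.lsmul ℝ ℝ V).toLinearMap ∘ₗ symι cs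

theorem wtEnd_apply (x : B →₀ ℝ) (v : V) : wtEnd cs V x v = symι cs x • v := rfl

theorem isNilHeckeFamily_connEnd {d : ∀ s, (demazureSkew cs s).Connection V}
    (hd : ∀ s v, d s (d s v) = 0) :
    IsNilHeckeFamily M (wtEnd cs V) fun s => connEnd (d s) where
  comm x y := by
    rw [wtEnd, LinearMap.comp_apply, LinearMap.comp_apply]
    exact (map_mul (Algebra.lsmul ℝ ℝ V) _ _).symm.trans
      ((congrArg _ (mul_comm _ _)).trans (map_mul (Algebra.lsmul ℝ ℝ V) _ _))
  twistedWeyl s x := LinearMap.ext fun v => by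
    change d s (symι cs x • v) = symι cs (geomReflection M s x) • d s v +
      algebraMap ℝ (Module.End ℝ V) (coroot M s x) v
    rw [(d s).apply_smul]
    change demazure cs s (symι cs x) • v +
      (symι cs x - symRoot cs s * demazure cs s (symι cs x)) • d s v = _
    rw [sub_symRoot_mul_demazure, simple_smul_ι, demazure_ι, algebraMap_smul,
      Module.algebraMap_end_apply, add_comm]
  nil s := LinearMap.ext fun v => hd s v

theorem smul_mem_ker_of_semilinear {T : Module.End ℝ V} {ρ : Module.End ℝ (B →₀ ℝ)}
    (hT : ∀ x, T * wtEnd cs V x = wtEnd cs V (ρ x) * T) (f : SymRing cs) {v : V} (hv : T v = 0) :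
    T (f • v) = 0 := by
  induction f using sym_induction generalizing v with
  | algebraMap c => rw [algebraMap_smul, map_smul, hv, smul_zero]
  | ι x =>
    rw [← wtEnd_apply, ← Module.End.mul_apply, hT, Module.End.mul_apply, hv, map_zero]
  | mul f g hf hg => rw [mul_smul, hf (hg hv)]
  | add f g hf hg => rw [add_smul, map_add, hf hv, hg hv, add_zero]

/-- The difference of the two sides of a braid relation is semilinear, so that its kernel is a
submodule. -/
theorem isBraided_connEnd_of_span {d : ∀ s, (demazureSkew cs s).Connection V}
    (hd : ∀ s v, d s (d s v) = 0) {X : Set V} (hX : Submodule.span (SymRing cs) X = ⊤)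
    (hb : ∀ ⦃c : Bool → B⦄ ⦃m : ℕ⦄, (∀ b, M (c b) (c !b) = m) → 2 ≤ m → ∀ b, ∀ v ∈ X,
      altWord (fun i => connEnd (d (c i))) (!b) m v = altWord (fun i => connEnd (d (c i))) b m v) :
    IsBraided M fun s => connEnd (d s) := fun c m hc hm b => by
  rw [← sub_eq_zero]
  refine LinearMap.ext fun v => ?_
  have hv : v ∈ Submodule.span (SymRing cs) X := hX ▸ Submodule.mem_top
  have sub_mul := (isNilHeckeFamily_connEnd hd).altWord_sub_mul hc hm (!b)
  rw [Bool.not_not] at sub_mul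
  induction hv using Submodule.span_induction with
  | mem v hv => rw [LinearMap.sub_apply, hb hc hm b v hv, sub_self, LinearMap.zero_apply]
  | zero => rw [map_zero, map_zero]
  | add v v' _ _ hv hv' => rw [map_add, hv, hv', map_add]
  | smul f v _ hv => rw [smul_mem_ker_of_semilinear sub_mul f hv, LinearMap.zero_apply]

/-- A family of connections over the Demazure operators which turns the module `V` over `R` into
a module over the nil Hecke algebra. -/
structure IsNilHeckeModule (d : ∀ s, (demazureSkew cs s).Connection V) : Prop where
  nil : ∀ s v, d s (d s v) = 0
  braid : IsBraided M fun s => connEnd (d s)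

namespace IsNilHeckeModule

variable {d : ∀ s, (demazureSkew cs s).Connection V} (hd : IsNilHeckeModule d)

/-- The representation of the nil Hecke algebra in which `∂_s` acts by the connection `d s`. -/
def rep : NilHecke cs →ₐ[ℝ] Module.End ℝ V :=
  nhLift cs (isNilHeckeFamily_connEnd hd.nil) hd.braid

theorem rep_del (s : B) (v : V) : hd.rep (del cs s) v = d s v := by
  rw [rep, nhLift_del, connEnd_apply]

theorem rep_wt (x : B →₀ ℝ) (v : V) : hd.rep (wt cs x) v = symι cs x • v := by
  rw [rep, nhLift_wt, wtEnd_apply]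

theorem rep_sym (r : SymRing cs) (v : V) : hd.rep (symIncl cs r) v = r • v := by
  induction r using sym_induction generalizing v with
  | algebraMap c => rw [AlgHom.commutes, AlgHom.commutes, Module.algebraMap_end_apply,
      algebraMap_smul]
  | ι x => rw [symIncl_ι, rep_wt]
  | mul f g hf hg => rw [map_mul, map_mul, Module.End.mul_apply, hf, hg, mul_smul]
  | add f g hf hg => rw [map_add, map_add, LinearMap.add_apply, hf, hg, add_smul]

theorem rep_smul (r : SymRing cs) (h : NilHecke cs) (v : V) :
    hd.rep (r • h) v = r • hd.rep h v := by
  rw [sym_smul_def, map_mul, Module.End.mul_apply, rep_sym]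

theorem rep_del_mul (s : B) (h : NilHecke cs) (v : V) :
    hd.rep (del cs s * h) v = d s (hd.rep h v) := by
  rw [map_mul, Module.End.mul_apply, rep_del]

theorem rep_reflElt (s : B) (v : V) : hd.rep (reflElt cs s) v = (d s).twist v := by
  rw [reflElt_eq, map_sub, map_one, LinearMap.sub_apply, rep_smul, rep_del]
  rfl

/-- The action of the nil Hecke algebra on a vector, as a linear map. -/
def orbit (v : V) : NilHecke cs →ₗ[SymRing cs] V where
  toFun h := hd.rep h v
  map_add' h h' := by rw [map_add, LinearMap.add_apply]
  map_smul' r h := hd.rep_smul r h v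

theorem orbit_apply (v : V) (h : NilHecke cs) : hd.orbit v h = hd.rep h v := rfl

theorem orbit_one (v : V) : hd.orbit v 1 = v := by
  rw [orbit_apply, map_one, Module.End.one_apply]

theorem intertwines_orbit (v : V) (s : B) : (delConn cs s).Intertwines (d s) (hd.orbit v) :=
  fun h => hd.rep_del_mul s h v

variable [Module ℝ V'] [IsScalarTower ℝ (SymRing cs) V']
  {d' : ∀ s, (demazureSkew cs s).Connection V'}

theorem map_rep (hd' : IsNilHeckeModule d') {φ : V →ₗ[SymRing cs] V'}
    (hφ : ∀ s, (d s).Intertwines (d' s) φ) (h : NilHecke cs) (v : V) :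
    φ (hd.rep h v) = hd'.rep h (φ v) := by
  induction h using nh_induction with
  | one => rw [map_one, map_one, Module.End.one_apply, Module.End.one_apply]
  | add h h' hh hh' => rw [map_add, map_add, LinearMap.add_apply, LinearMap.add_apply, map_add,
      hh, hh']
  | smul r h hh => rw [rep_smul, rep_smul, map_smul, hh]
  | del_mul s h hh => rw [rep_del_mul, rep_del_mul, hφ s, hh]

end IsNilHeckeModule

omit [Module ℝ V] [IsScalarTower ℝ (SymRing cs) V] in
theorem nh_linearMap_ext {d : ∀ s, (demazureSkew cs s).Connection V}
    {φ ψ : NilHecke cs →ₗ[SymRing cs] V} (hφ : ∀ s, (delConn cs s).Intertwines (d s) φ)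
    (hψ : ∀ s, (delConn cs s).Intertwines (d s) ψ) (h1 : φ 1 = ψ 1) : φ = ψ :=
  LinearMap.ext fun h => by
    induction h using nh_induction with
    | one => exact h1
    | add h h' hh hh' => rw [map_add, map_add, hh, hh']
    | smul r h hh => rw [map_smul, map_smul, hh]
    | del_mul s h hh => rw [← delConn_apply, hφ, hψ, hh]

variable [Module ℝ V'] [IsScalarTower ℝ (SymRing cs) V']

theorem map_altWord_connEnd {d : ∀ s, (demazureSkew cs s).Connection V}
    {d' : ∀ s, (demazureSkew cs s).Connection V'} {φ : V →ₗ[SymRing cs] V'}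
    (hφ : ∀ s, (d s).Intertwines (d' s) φ) (c : Bool → B) (b : Bool) (n : ℕ) (v : V) :
    φ (altWord (fun i => connEnd (d (c i))) b n v) =
      altWord (fun i => connEnd (d' (c i))) b n (φ v) := by
  induction n generalizing b with
  | zero => rfl
  | succ n ih =>
    rw [altWord_succ, altWord_succ, Module.End.mul_apply, Module.End.mul_apply, connEnd_apply,
      connEnd_apply, hφ, ih]

end Representation

/-! ### The polynomial representation -/

section PolynomialRepresentation

open SkewDerivation.Connection

variable {B W : Type*} [Group W] {M : CoxeterMatrix B} (cs : CoxeterSystem M W)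

theorem isNilHeckeModule_unit : IsNilHeckeModule fun s => unit (demazureSkew cs s) where
  nil := demazure_demazure
  braid := isBraided_connEnd_of_span demazure_demazure (X := {1})
      (Ideal.span_singleton_one) fun c m _ hm b v hv => by
    obtain rfl : v = 1 := hv
    have altWord_one_eq_zero (b : Bool) :
        altWord (fun i => connEnd (unit (demazureSkew cs (c i)))) b m 1 = 0 := by
      obtain ⟨n, rfl⟩ : ∃ n, m = n + 1 := ⟨m - 1, by omega⟩
      have demazure_one : demazure cs (c (altLetter b n)) 1 = 0 := by
        rw [← map_one (algebraMap ℝ _), demazure_algebraMap]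
      rw [altWord_succ_right, Module.End.mul_apply, connEnd_apply, unit_apply]
      exact (congrArg _ demazure_one).trans (map_zero _)
    rw [altWord_one_eq_zero, altWord_one_eq_zero]

/-- The polynomial representation of the nil Hecke algebra, by Demazure operators. -/
def polyRep : NilHecke cs →ₐ[ℝ] Module.End ℝ (SymRing cs) := (isNilHeckeModule_unit cs).rep

theorem polyRep_sym (r f : SymRing cs) : polyRep cs (symIncl cs r) f = r * f :=
  (isNilHeckeModule_unit cs).rep_sym r f

theorem polyRep_del (s : B) : polyRep cs (del cs s) = demazure cs s :=
  LinearMap.ext ((isNilHeckeModule_unit cs).rep_del s)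

theorem polyRep_reflElt (s : B) (f : SymRing cs) :
    polyRep cs (reflElt cs s) f = cs.simple s • f :=
  ((isNilHeckeModule_unit cs).rep_reflElt s f).trans (sub_symRoot_mul_demazure cs s f)

theorem symIncl_injective : Function.Injective (symIncl cs) := fun r r' h => by
  rw [← mul_one r, ← polyRep_sym, h, polyRep_sym, mul_one]

/-- The value of the polynomial representation at a polynomial `f`, as a linear functional. -/
def polyEval (f : SymRing cs) : NilHecke cs →ₗ[SymRing cs] SymRing cs :=
  (isNilHeckeModule_unit cs).orbit f

theorem polyEval_apply (f : SymRing cs) (h : NilHecke cs) : polyEval cs f h = polyRep cs h f := rfl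

theorem polyEval_mul (f : SymRing cs) (h h' : NilHecke cs) :
    polyEval cs f (h * h') = polyEval cs (polyEval cs f h') h := by
  rw [polyEval_apply, map_mul, Module.End.mul_apply, polyEval_apply, polyEval_apply]

end PolynomialRepresentation

/-! ### Nilpotent letters -/

section NilWords

variable {A : Type*} [Ring A] {D : Bool → A} (hn : ∀ b, D b * D b = 0)

include hn

theorem altWord_mul_eq_zero {b b' : Bool} {n k : ℕ} (hn0 : n ≠ 0) (hk0 : k ≠ 0)
    (hb : b' ≠ altLetter b n) : altWord D b n * altWord D b' k = 0 := by
  obtain ⟨n, rfl⟩ := Nat.exists_eq_add_one_of_ne_zero hn0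
  obtain ⟨k, rfl⟩ := Nat.exists_eq_add_one_of_ne_zero hk0
  rw [altLetter_succ, Bool.ne_not] at hb
  rw [altWord_succ_right, altWord_succ, hb, mul_assoc, ← mul_assoc (D _), hn, zero_mul, mul_zero]

variable {m : ℕ} (hm : m ≠ 0) (hb : ∀ b, altWord D (!b) m = altWord D b m)

include hm hb

theorem altWord_eq_zero {b : Bool} {n : ℕ} (hnm : m < n) : altWord D b n = 0 := by
  obtain ⟨k, rfl⟩ : ∃ k, n = m + 1 + k := ⟨n - (m + 1), by omega⟩
  obtain ⟨l, rfl⟩ := Nat.exists_eq_add_one_of_ne_zero hm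
  rw [altWord_add, altWord_succ, hb, altWord_succ, ← mul_assoc (D b), hn, zero_mul, zero_mul]

omit hn hm hb in
/-- The alternating words of length at most `m`, where the two words of length `m`, and those of
length `0`, are not distinguished. -/
abbrev WordIndex (m : ℕ) : Type :=
  {p : Bool × ℕ // p.2 ≤ m ∧ (p.1 = true ∨ (0 < p.2 ∧ p.2 < m))}

theorem altWord_mul_complement {i j : WordIndex m} (hij : j ≠ i) (hle : i.1.2 ≤ j.1.2) :
    altWord D j.1.1 j.1.2 * altWord D (altLetter i.1.1 i.1.2) (m - i.1.2) = 0 := by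
  obtain ⟨⟨b, n⟩, hi, hi'⟩ := i
  obtain ⟨⟨c, k⟩, hj, hj'⟩ := j
  simp only [ne_eq, Subtype.mk.injEq, Prod.mk.injEq] at *
  by_cases h : altLetter b n = altLetter c k
  · have hkn : k ≠ n := by
      rintro rfl
      exact hij ⟨Bool.xor_left_inj.1 h.symm, rfl⟩
    rw [h, ← altWord_add]
    exact altWord_eq_zero hn hm hb (by omega)
  · refine altWord_mul_eq_zero hn ?_ ?_ h
    · rintro rfl
      obtain rfl : n = 0 := by omega
      simp_all
    · intro h0
      obtain rfl : n = m := by omega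
      obtain rfl : k = n := by omega
      simp_all

omit hn hm hb in
theorem altWord_mem_range_of_le (hb : ∀ b, altWord D (!b) m = altWord D b m) (b : Bool) {n : ℕ}
    (hnm : n ≤ m) : altWord D b n ∈ Set.range fun i : WordIndex m => altWord D i.1.1 i.1.2 := by
  by_cases h : b = true ∨ (0 < n ∧ n < m)
  · exact ⟨⟨(b, n), hnm, h⟩, rfl⟩
  · refine ⟨⟨(true, n), hnm, .inl rfl⟩, ?_⟩
    obtain rfl : b = !true := by simpa using fun hb => h (.inl hb)
    rcases Nat.eq_zero_or_pos n with rfl | h0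
    · rfl
    · obtain rfl : n = m := by omega
      exact (hb true).symm

end NilWords

section Reflections

variable {B W : Type*} [Group W] {M : CoxeterMatrix B} (cs : CoxeterSystem M W) (s : B)

theorem del_mul_reflElt : del cs s * reflElt cs s = -del cs s := by
  have h := apply_twist_of_nil (delConn_delConn cs s) 1
  rwa [delConn_twist, delConn_apply, delConn_apply, mul_one, mul_one] at h

theorem reflElt_mul_reflElt : reflElt cs s * reflElt cs s = 1 := by
  have h := twist_twist_of_nil (delConn_delConn cs s) 1
  rwa [delConn_twist, delConn_twist, mul_one] at h

end Reflections

/-! ### Dihedral subalgebras -/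

section Dihedral

open SkewDerivation.Connection

variable {B W : Type*} [Group W] {M : CoxeterMatrix B} (cs : CoxeterSystem M W) {c : Bool → B}

/-- The `R`-submodule of the nil Hecke algebra spanned by the alternating words of length at most
`m` in two of the generators `∂_s`. -/
def dihedralSpan (c : Bool → B) (m : ℕ) : Submodule (SymRing cs) (NilHecke cs) :=
  Submodule.span _ (Set.range fun i : WordIndex m => altWord (fun i => del cs (c i)) i.1.1 i.1.2)

variable {m : ℕ} (hc : ∀ b, M (c b) (c !b) = m) (hm : 2 ≤ m)

include hc hm

theorem linearIndependent_polyEval_altWord :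
    LinearIndependent (SymRing cs) fun (i : WordIndex m) f =>
      polyEval cs f (altWord (fun i => del cs (c i)) i.1.1 i.1.2) := by
  set D := fun i => del cs (c i)
  refine linearIndependent_iff'.2 fun S g hg => ?_
  suffices H : ∀ n, ∀ i ∈ S, i.1.2 = n → g i = 0 from fun i hi => H _ i hi rfl
  intro n
  induction n using Nat.strong_induction_on with
  | _ n ih =>
    intro i hi hin
    -- right multiplication by the complement of `i` kills the words which are not shorter
    obtain ⟨f, hf⟩ : ∃ f, polyEval cs f (altWord D i.1.1 m) ≠ 0 := by
      have h := (isNilHeckeFamily_connEnd (d := fun s => unit (demazureSkew cs s))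
        demazure_demazure).altWord_ne_zero hc hm i.1.1 le_rfl
      contrapose! h
      refine LinearMap.ext fun f => .trans ?_ (h f)
      rw [polyEval_apply, map_altWord]
      simp only [D, polyRep_del]
      rfl
    have h1 := congrFun hg (polyEval cs f (altWord D (altLetter i.1.1 i.1.2) (m - i.1.2)))
    rw [Finset.sum_apply, Finset.sum_eq_single i] at h1
    · rw [Pi.smul_apply, ← polyEval_mul, ← altWord_add, Nat.add_sub_cancel' i.2.1] at h1
      exact (mul_eq_zero.1 h1).resolve_right hf
    · intro j hj hji
      rw [Pi.smul_apply, ← polyEval_mul]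
      rcases lt_or_ge j.1.2 i.1.2 with hlt | hge
      · rw [ih j.1.2 (by omega) j hj rfl, zero_smul]
      · rw [altWord_mul_complement (fun b => (isNilHeckeFamily_wt_del cs).nil (c b)) (by omega)
          (isBraided_del cs hc hm) hji hge, map_zero, smul_zero]
    · exact fun h => absurd hi h

theorem altWord_mem_dihedralSpan (b : Bool) (n : ℕ) :
    altWord (fun i => del cs (c i)) b n ∈ dihedralSpan cs c m := by
  rcases lt_or_ge m n with h | h
  · rw [altWord_eq_zero (fun b => (isNilHeckeFamily_wt_del cs).nil (c b)) (by omega)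
      (isBraided_del cs hc hm) h]
    exact zero_mem _
  · exact Submodule.subset_span (altWord_mem_range_of_le (isBraided_del cs hc hm) b h)

theorem one_mem_dihedralSpan : 1 ∈ dihedralSpan cs c m :=
  altWord_mem_dihedralSpan cs hc hm true 0

theorem delConn_mem_dihedralSpan (b : Bool) {h : NilHecke cs} (hh : h ∈ dihedralSpan cs c m) :
    delConn cs (c b) h ∈ dihedralSpan cs c m := by
  refine apply_mem_of_mem_span Submodule.subset_span ?_ hh
  rintro _ ⟨⟨⟨b', n⟩, -⟩, rfl⟩
  change del cs (c b) * altWord (fun i => del cs (c i)) b' n ∈ dihedralSpan cs c m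
  by_cases hb : b' = !b
  · rw [hb, ← altWord_succ (fun i => del cs (c i))]
    exact altWord_mem_dihedralSpan cs hc hm _ _
  · obtain rfl := Bool.ne_not.1 hb
    rcases n with _ | n
    · rw [altWord_zero, mul_one, ← altWord_one (fun i => del cs (c i))]
      exact altWord_mem_dihedralSpan cs hc hm _ _
    · rw [altWord_succ, ← mul_assoc, (isNilHeckeFamily_wt_del cs).nil, zero_mul]
      exact zero_mem _

theorem reflElt_pow_mem_dihedralSpan (b : Bool) (n : ℕ) :
    (reflElt cs (c b) * reflElt cs (c !b)) ^ n ∈ dihedralSpan cs c m := by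
  have reflElt_mul_mem (b : Bool) {h : NilHecke cs} (hh : h ∈ dihedralSpan cs c m) :
      reflElt cs (c b) * h ∈ dihedralSpan cs c m := by
    rw [← delConn_twist]
    exact sub_mem hh (Submodule.smul_mem _ _ (delConn_mem_dihedralSpan cs hc hm b hh))
  induction n with
  | zero =>
    rw [pow_zero]
    exact one_mem_dihedralSpan cs hc hm
  | succ n ih =>
    rw [pow_succ', mul_assoc]
    exact reflElt_mul_mem b (reflElt_mul_mem _ ih)

theorem eq_of_mem_dihedralSpan {h h' : NilHecke cs} (hh : h ∈ dihedralSpan cs c m)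
    (hh' : h' ∈ dihedralSpan cs c m) (hp : polyRep cs h = polyRep cs h') : h = h' := by
  rw [← sub_eq_zero] at hp ⊢
  refine eq_zero_of_mem_span_of_forall_eq_zero (linearIndependent_polyEval_altWord cs hc hm)
    (sub_mem hh hh') fun f => ?_
  rw [polyEval_apply, map_sub, hp, LinearMap.zero_apply]

omit hc hm

theorem reflElt_isLiftable : M.IsLiftable (reflElt cs) := by
  intro s t
  by_cases hst : s = t
  · rw [hst, M.diagonal, pow_one, reflElt_mul_reflElt]
  rcases Nat.eq_zero_or_pos (M s t) with h0 | hpos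
  · rw [h0, pow_zero]
  have polyRep_reflElt_eq (s : B) : polyRep cs (reflElt cs s) =
      DistribMulAction.toModuleEnd ℝ (SymRing cs) (cs.simple s) :=
    LinearMap.ext (polyRep_reflElt cs s)
  have hc (b : Bool) : M (cond b s t) (cond (!b) s t) = M s t := by
    cases b
    exacts [M.symmetric t s, rfl]
  have hm : 2 ≤ M s t := by
    have := M.off_diagonal s t hst
    omega
  refine eq_of_mem_dihedralSpan cs hc hm (reflElt_pow_mem_dihedralSpan cs hc hm true _)
    (one_mem_dihedralSpan cs hc hm) ?_
  rw [map_pow, map_mul, map_one, polyRep_reflElt_eq, polyRep_reflElt_eq, ← map_mul, ← map_pow]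
  exact (congrArg _ (cs.simple_mul_simple_pow s t)).trans (map_one _)

end Dihedral

open SkewDerivation SkewDerivation.Connection

variable {B W : Type*} [Group W] {M : CoxeterMatrix B} (cs : CoxeterSystem M W)

/-! ### The comultiplication -/

section Comultiplication

local notation "R" => SymRing cs
local notation "H" => NilHecke cs

/-- The operator `h ⊗ h' ↦ ∂_s h ⊗ h' + s h ⊗ ∂_s h'` on the tensor square of the nil Hecke
algebra. -/
def tensorConn (s : B) : (demazureSkew cs s).Connection (H ⊗[R] H) :=
  (delConn cs s).tensor (delConn cs s)

theorem intertwines_mulR (a : H) (s : B) :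
    (delConn cs s).Intertwines (delConn cs s) (mulR R H a) := fun h => mul_assoc (del cs s) h a

theorem intertwines_actR (a b : H) (s : B) :
    (tensorConn cs s).Intertwines (tensorConn cs s) (actR R H a b) :=
  (intertwines_mulR cs a s).map (intertwines_mulR cs b s)

theorem tensorConn_nil (s : B) (z : H ⊗[R] H) : tensorConn cs s (tensorConn cs s z) = 0 :=
  tensor_nil (delConn_delConn cs s) (delConn_delConn cs s) z

theorem intertwines_polyEval (f : R) (s : B) :
    (delConn cs s).Intertwines (unit (demazureSkew cs s)) (polyEval cs f) :=
  (isNilHeckeModule_unit cs).intertwines_orbit f s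

section Braid

variable {c : Bool → B} {m : ℕ} (hc : ∀ b, M (c b) (c !b) = m) (hm : 2 ≤ m)

include hc hm

theorem altWord_tensorConn_mem (b : Bool) (n : ℕ) :
    altWord (fun i => connEnd (tensorConn cs (c i))) b n (1 ⊗ₜ[R] 1) ∈
      Submodule.map₂ (TensorProduct.mk R H H) (dihedralSpan cs c m) (dihedralSpan cs c m) := by
  induction n generalizing b with
  | zero =>
    exact Submodule.apply_mem_map₂ _ (one_mem_dihedralSpan cs hc hm) (one_mem_dihedralSpan cs hc hm)
  | succ n ih =>
    rw [altWord_succ, Module.End.mul_apply]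
    exact tensor_mem_map₂_mk (fun _ => delConn_mem_dihedralSpan cs hc hm b)
      (fun _ => delConn_mem_dihedralSpan cs hc hm b) (ih _)

theorem eq_zero_of_tensorEval_polyEval {z : H ⊗[R] H}
    (hz : z ∈ Submodule.map₂ (TensorProduct.mk R H H) (dihedralSpan cs c m) (dihedralSpan cs c m))
    (h : ∀ f g, tensorEval (polyEval cs f) (polyEval cs g) z = 0) : z = 0 := by
  have hv := linearIndependent_polyEval_altWord cs hc hm
  set w := fun i : WordIndex m => altWord (fun i => del cs (c i)) i.1.1 i.1.2
  have hvv : LinearIndependent R fun (p : WordIndex m × WordIndex m) (q : R × R) =>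
      tensorEval (polyEval cs q.1) (polyEval cs q.2) (w p.1 ⊗ₜ w p.2) := by
    simpa only [tensorEval_tmul] using linearIndependent_mul hv hv
  rw [dihedralSpan, Submodule.map₂_span_span, Set.image2_range] at hz
  exact eq_zero_of_mem_span_of_forall_eq_zero hvv hz fun p => h p.1 p.2

/-- Pairs of polynomials separate the span of the pairs of words, and turn the operators on the
tensor square into Demazure operators. -/
theorem altWord_tensorConn_one (b : Bool) :
    altWord (fun i => connEnd (tensorConn cs (c i))) (!b) m (1 ⊗ₜ[R] 1) =
      altWord (fun i => connEnd (tensorConn cs (c i))) b m (1 ⊗ₜ[R] 1) := by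
  refine sub_eq_zero.1 (eq_zero_of_tensorEval_polyEval cs hc hm
    (sub_mem (altWord_tensorConn_mem cs hc hm _ _) (altWord_tensorConn_mem cs hc hm _ _))
    fun f g => ?_)
  have h := map_altWord_connEnd (d := tensorConn cs)
    (fun s => (intertwines_polyEval cs f s).tensorEval (intertwines_polyEval cs g s)) c
  rw [map_sub, h, h, (isNilHeckeModule_unit cs).braid hc hm, sub_self]

end Braid

theorem isNilHeckeModule_tensorConn : IsNilHeckeModule (tensorConn cs) where
  nil := tensorConn_nil cs
  braid := isBraided_connEnd_of_span (tensorConn_nil cs) (TensorProduct.span_tmul_eq_top R H H)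
    fun c m hc hm b z hz => by
      obtain ⟨h, h', rfl⟩ := hz
      have := map_altWord_connEnd (intertwines_actR cs h h') c
      rw [← one_mul h, ← one_mul h', ← actR_tmul, ← this, ← this, altWord_tensorConn_one cs hc hm]

/-- The comultiplication of the nil Hecke algebra as a linear map, which is the action on
`1 ⊗ 1`. -/
def nhComulₗ : H →ₗ[R] H ⊗[R] H := (isNilHeckeModule_tensorConn cs).orbit (1 ⊗ₜ 1)

theorem nhComulₗ_one : nhComulₗ cs 1 = 1 ⊗ₜ 1 := (isNilHeckeModule_tensorConn cs).orbit_one _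

theorem intertwines_nhComulₗ (s : B) :
    (delConn cs s).Intertwines (tensorConn cs s) (nhComulₗ cs) :=
  (isNilHeckeModule_tensorConn cs).intertwines_orbit _ s

theorem nhComulₗ_del (s : B) :
    nhComulₗ cs (del cs s) = del cs s ⊗ₜ 1 + reflElt cs s ⊗ₜ del cs s := by
  have h := intertwines_nhComulₗ cs s 1
  rwa [nhComulₗ_one, tensorConn, tensor_tmul, delConn_twist, delConn_apply, mul_one, mul_one] at h

theorem nhComulₗ_del' (s : B) :
    nhComulₗ cs (del cs s) = del cs s ⊗ₜ reflElt cs s + 1 ⊗ₜ del cs s := by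
  have h := intertwines_nhComulₗ cs s 1
  rwa [nhComulₗ_one, tensorConn, tensor_tmul', delConn_twist, delConn_apply, mul_one, mul_one] at h

theorem actR_nhComulₗ (a b h : H) : actR R H a b (nhComulₗ cs h) =
    (isNilHeckeModule_tensorConn cs).rep h (a ⊗ₜ b) := by
  have hd := isNilHeckeModule_tensorConn cs
  refine (hd.map_rep hd (intertwines_actR cs a b) h _).trans ?_
  rw [actR_tmul, one_mul, one_mul]

theorem nhComulₗ_mem_takeuchi (h : H) : nhComulₗ cs h ∈ takeuchi R H := fun r => by
  rw [actR_nhComulₗ, actR_nhComulₗ, incl_apply, ← TensorProduct.smul_tmul]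

theorem takMul_nhComulₗ (h : H) (z : H ⊗[R] H) :
    takMul (nhComulₗ cs h) (nhComulₗ_mem_takeuchi cs h) z =
      (isNilHeckeModule_tensorConn cs).rep h z := by
  induction z with
  | zero => rw [map_zero, map_zero]
  | add y z hy hz => rw [map_add, map_add, hy, hz]
  | tmul a b => rw [takMul_tmul, actR_nhComulₗ]

theorem incl_nh (r : R) : incl R H r = symIncl cs r := mul_one _

/-- The comultiplication of the nil Hecke algebra as an algebra morphism. -/
def nhComul : H →ₐ[ℝ] takeuchi R H where
  toFun h := ⟨nhComulₗ cs h, nhComulₗ_mem_takeuchi cs h⟩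
  map_one' := Subtype.ext (nhComulₗ_one cs)
  map_zero' := Subtype.ext (map_zero _)
  map_add' h h' := Subtype.ext (map_add _ h h')
  map_mul' h h' := Subtype.ext <| by
    rw [coe_mul_takeuchi, takMul_nhComulₗ]
    exact DFunLike.congr_fun (map_mul (isNilHeckeModule_tensorConn cs).rep h h') _
  commutes' c := by
    rw [← AlgHom.commutes (inclTakeuchi ℝ R H)]
    refine Subtype.ext ?_
    change nhComulₗ cs (algebraMap ℝ H c) = _
    rw [coe_inclTakeuchi, ← nhComulₗ_one, ← map_smul, ← incl_apply, incl_algebraMap]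

theorem nhComul_sym (r : R) : nhComul cs (symIncl cs r) = inclTakeuchi ℝ R H r := Subtype.ext <| by
  change nhComulₗ cs (symIncl cs r) = _
  rw [coe_inclTakeuchi, ← nhComulₗ_one, ← map_smul, ← incl_apply, incl_nh]

end Comultiplication

/-! ### The bialgebroid -/

section Bialgebroid

local notation "R" => SymRing cs
local notation "H" => NilHecke cs

theorem polyEval_one (f : R) : polyEval cs f 1 = f := (isNilHeckeModule_unit cs).orbit_one f

theorem nhComulₗ_coassoc :
    (TensorProduct.assoc R H H H).toLinearMap ∘ₗ (nhComulₗ cs).rTensor H ∘ₗ nhComulₗ cs =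
      (nhComulₗ cs).lTensor H ∘ₗ nhComulₗ cs :=
  have hΔ := intertwines_nhComulₗ cs
  nh_linearMap_ext (fun s => Intertwines.assoc.comp (((hΔ s).map .id).comp (hΔ s)))
    (fun s => (Intertwines.id.map (hΔ s)).comp (hΔ s)) <| by
      simp only [LinearMap.comp_apply, nhComulₗ_one, LinearMap.rTensor_tmul,
        LinearMap.lTensor_tmul, LinearEquiv.coe_coe, TensorProduct.assoc_tmul]

theorem lid_rTensor_polyEval_nhComulₗ :
    (TensorProduct.lid R H).toLinearMap ∘ₗ (polyEval cs 1).rTensor H ∘ₗ nhComulₗ cs = .id :=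
  nh_linearMap_ext (fun s => Intertwines.lid.comp
      (((intertwines_polyEval cs 1 s).map .id).comp (intertwines_nhComulₗ cs s)))
    (fun _ => .id) <| by
      simp only [LinearMap.comp_apply, nhComulₗ_one, LinearMap.rTensor_tmul, polyEval_one,
        LinearEquiv.coe_coe, TensorProduct.lid_tmul, one_smul, LinearMap.id_apply]

theorem comm_nhComulₗ :
    (TensorProduct.comm R H H).toLinearMap ∘ₗ nhComulₗ cs = nhComulₗ cs :=
  nh_linearMap_ext (fun s => Intertwines.comm.comp (intertwines_nhComulₗ cs s))
    (intertwines_nhComulₗ cs) <| by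
      rw [LinearMap.comp_apply, nhComulₗ_one, LinearEquiv.coe_coe, TensorProduct.comm_tmul]

theorem rTensor_polyEval_nhComulₗ (h : H) :
    (polyEval cs 1).rTensor H (nhComulₗ cs h) = 1 ⊗ₜ h := by
  apply (TensorProduct.lid R H).injective
  rw [TensorProduct.lid_tmul, one_smul]
  exact LinearMap.congr_fun (lid_rTensor_polyEval_nhComulₗ cs) h

/-- The coalgebra structure of the nil Hecke algebra over `R`. -/
instance nhCoalgebra : Coalgebra R H where
  comul := nhComulₗ cs
  counit := polyEval cs 1
  coassoc := nhComulₗ_coassoc cs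
  rTensor_counit_comp_comul := LinearMap.ext (rTensor_polyEval_nhComulₗ cs)
  lTensor_counit_comp_comul := by
    refine LinearMap.ext fun h => ?_
    rw [← comm_nhComulₗ, ← LinearMap.comm_comp_rTensor_comp_comm_eq, LinearMap.comp_apply]
    simp only [LinearMap.comp_apply, LinearEquiv.coe_coe, TensorProduct.comm_comm,
      rTensor_polyEval_nhComulₗ, TensorProduct.comm_tmul, LinearMap.flip_apply,
      TensorProduct.mk_apply]

instance nh_isCocomm : Coalgebra.IsCocomm R H where
  comm_comp_comul := comm_nhComulₗ cs

theorem nh_isLeftBialgebroid : IsLeftBialgebroid ℝ R H where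
  incl_injective r r' h := symIncl_injective cs (by rwa [incl_nh, incl_nh] at h)
  comul_algHom := ⟨nhComul cs, fun _ => rfl⟩
  counit_rep := ⟨polyRep cs,
    fun h r => .symm <| (polyEval_mul cs 1 h _).trans <| by
      rw [incl_nh, polyEval_apply cs 1, polyRep_sym, mul_one, polyEval_apply],
    fun r r' => by rw [incl_nh, polyRep_sym]⟩

end Bialgebroid

/-! ### The translation map -/

section TranslationMap

open MulOpposite

local notation "R" => SymRing cs
local notation "H" => NilHecke cs

/-- The anti-automorphism of the nil Hecke algebra which fixes the generators. -/
def nhOp : H →ₐ[ℝ] Hᵐᵒᵖ :=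
  nhLift cs (isNilHeckeFamily_wt_del cs).op (isBraided_del cs).op

theorem nhOp_del (s : B) : nhOp cs (del cs s) = op (del cs s) := nhLift_del _ _ s

theorem nhOp_incl (r : R) : nhOp cs (incl R H r) = op (incl R H r) := by
  rw [incl_nh]
  induction r using sym_induction with
  | algebraMap c => rw [AlgHom.commutes, AlgHom.commutes, MulOpposite.algebraMap_apply]
  | ι x => rw [symIncl_ι, nhOp, nhLift_wt]; rfl
  | mul f g hf hg => rw [map_mul, map_mul, hf, hg, ← op_mul, ← map_mul, ← map_mul, mul_comm]
  | add f g hf hg => rw [map_add, map_add, hf, hg, op_add]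

theorem nhOp_reflElt (s : B) : nhOp cs (reflElt cs s) = op (-reflElt cs s) := by
  have h : del cs s * incl R H (symRoot cs s) = -(symRoot cs s • del cs s) + 2 := by
    rw [incl_nh, del_mul_sym, simple_smul_symRoot, map_neg, neg_mul, ← sym_smul_def, symRoot,
      demazure_ι, coroot_self, AlgHom.commutes, map_ofNat]
  rw [reflElt_eq, map_sub, map_one, ← incl_mul, map_mul, nhOp_del, nhOp_incl, ← op_mul, h, incl_mul,
    ← op_one, ← op_sub]
  congr 1
  rw [← one_add_one_eq_two]
  noncomm_ring

/-- The translation map of the nil Hecke algebra as an algebra morphism. -/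
def nhRed : H →ₐ[ℝ] balTakeuchi R H :=
  (AlgHom.opComm ((takeuchiToBal (nhOp_incl cs)).comp (nhComul cs))).comp (nhOp cs)

theorem coe_nhRed (h : H) :
    (nhRed cs h).1 = tensorToBal (nhOp_incl cs) (nhComulₗ cs (unop (nhOp cs h))) := rfl

theorem nhRed_incl (r : R) : (nhRed cs (incl R H r)).1 = balTmul R H (incl R H r) 1 := by
  rw [coe_nhRed, nhOp_incl, unop_op, incl_apply, map_smul, nhComulₗ_one, TensorProduct.smul_tmul',
    tensorToBal_tmul, ← incl_apply, nhOp_incl, unop_op]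

theorem nhRed_del (s : B) : (nhRed cs (del cs s)).1 =
    balTmul R H (del cs s) (reflElt cs s) + balTmul R H 1 (del cs s) := by
  rw [coe_nhRed, nhOp_del, unop_op, nhComulₗ_del', map_add, tensorToBal_tmul, tensorToBal_tmul,
    nhOp_del, unop_op, map_one, unop_one]

theorem nhRed_del' (s : B) : (nhRed cs (del cs s)).1 =
    balTmul R H (del cs s) 1 - balTmul R H (reflElt cs s) (del cs s) := by
  rw [coe_nhRed, nhOp_del, unop_op, nhComulₗ_del, map_add, tensorToBal_tmul, tensorToBal_tmul,
    nhOp_del, nhOp_reflElt, unop_op, unop_op, balTmul_neg_left, sub_eq_add_neg]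

theorem adjoin_incl_union_del :
    Algebra.adjoin ℝ (Set.range (incl R H) ∪ Set.range (del cs)) = ⊤ := by
  refine Algebra.eq_top_iff.2 fun h => ?_
  induction h using nh_induction with
  | one => exact one_mem _
  | add h h' hh hh' => exact add_mem hh hh'
  | smul r h hh =>
    exact incl_mul r h ▸ mul_mem (Algebra.subset_adjoin (.inl (Set.mem_range_self r))) hh
  | del_mul s h hh => exact mul_mem (Algebra.subset_adjoin (.inr (Set.mem_range_self s))) hh

theorem nh_comul_one : (Coalgebra.comul 1 : H ⊗[R] H) = 1 ⊗ₜ 1 := nhComulₗ_one cs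

theorem nh_comul_del (s : B) : (Coalgebra.comul (del cs s) : H ⊗[R] H) =
    del cs s ⊗ₜ reflElt cs s + 1 ⊗ₜ del cs s := nhComulₗ_del' cs s

theorem galois_nhRed_del (s : B) :
    galois (nh_isLeftBialgebroid cs) (nhRed cs (del cs s)).1 = del cs s ⊗ₜ 1 := by
  rw [nhRed_del, map_add, galois_balTmul, galois_balTmul, nh_comul_one, nh_comul_del, map_add]
  simp only [actR_tmul, mul_one, one_mul]
  rw [reflElt_mul_reflElt, del_mul_reflElt, TensorProduct.tmul_neg, neg_add_cancel_right]

theorem translationLift_comul_del (s : B) :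
    translationLift (nhRed_incl cs) (Coalgebra.comul (del cs s)) = balTmul R H (del cs s) 1 := by
  rw [nh_comul_del, map_add, translationLift_tmul, translationLift_tmul, nhRed_del, map_one,
    coe_one_balTakeuchi, map_add]
  simp only [actB_balTmul, mul_one, one_mul]
  rw [reflElt_mul_reflElt, del_mul_reflElt, balTmul_neg_right, neg_add_cancel_right]

theorem nh_galois_translation (h : H) :
    galois (nh_isLeftBialgebroid cs) (nhRed cs h).1 = h ⊗ₜ 1 ∧
      translationLift (nhRed_incl cs) (Coalgebra.comul h) = balTmul R H h 1 :=
  galois_translation_of_adjoin (nhRed_incl cs) (nh_isLeftBialgebroid cs)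
    (adjoin_incl_union_del cs) (Set.forall_mem_range.2 (galois_nhRed_del cs))
    (Set.forall_mem_range.2 (translationLift_comul_del cs)) h

theorem nh_isHopfAlgebroid : IsHopfAlgebroid ℝ R H where
  toIsLeftBialgebroid := nh_isLeftBialgebroid cs
  galois_bijective := galois_bijective_of_translation (nhRed_incl cs) _
    (fun h => (nh_galois_translation cs h).1) fun h => (nh_galois_translation cs h).2

theorem red_nh (h : H) : (nh_isHopfAlgebroid cs).red h = (nhRed cs h).1 :=
  IsHopfAlgebroid.red_eq_of_galois_eq _ (nh_galois_translation cs h).1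

end TranslationMap

/-! ### The nil Coxeter module -/

section NilCoxeterModule

open scoped Classical in
/-- The operators of the nil Coxeter module, which is free with basis `W`: they send the basis
vector of `w` to that of `s w` if this is longer, and to zero otherwise. -/
def nilConn (s : B) : (demazureSkew cs s).Connection (W →₀ SymRing cs) :=
  free (demazureSkew cs s) fun w =>
    if cs.length (cs.simple s * w) = cs.length w + 1 then Finsupp.single (cs.simple s * w) 1 else 0

open scoped Classical in
theorem nilConn_single_one (s : B) (w : W) : nilConn cs s (Finsupp.single w 1) =
    if cs.length (cs.simple s * w) = cs.length w + 1 then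
      Finsupp.single (cs.simple s * w) 1 else 0 := by
  have demazure_one : (demazureSkew cs s).toFun 1 = 0 :=
    (congrArg (demazure cs s) (map_one (algebraMap ℝ _)).symm).trans (demazure_algebraMap s 1)
  rw [nilConn, free_single, demazure_one, Finsupp.single_zero, mul_zero, sub_zero, one_smul,
    zero_add]

theorem span_range_single_one :
    Submodule.span (SymRing cs) (Set.range fun w : W => Finsupp.single w (1 : SymRing cs)) = ⊤ :=
  Finsupp.coe_basisSingleOne (R := SymRing cs) (ι := W) ▸ Finsupp.basisSingleOne.span_eq

theorem nilConn_nilConn (s : B) (v : W →₀ SymRing cs) : nilConn cs s (nilConn cs s v) = 0 := by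
  refine nil_of_span (span_range_single_one cs) (Set.forall_mem_range.2 fun w => ?_) v
  rw [nilConn_single_one]
  split_ifs with h
  · rw [nilConn_single_one, cs.simple_mul_simple_cancel_left, if_neg (by omega)]
  · exact map_zero _

theorem length_altWord_mul_le (c : Bool → B) (b : Bool) (n : ℕ) (w : W) :
    cs.length (altWord (fun i => cs.simple (c i)) b n * w) ≤ n + cs.length w := by
  induction n generalizing b with
  | zero => rw [altWord_zero, one_mul, zero_add]
  | succ n ih =>
    rw [altWord_succ, mul_assoc]
    have length_simple_mul := cs.length_mul_le (cs.simple (c b))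
      (altWord (fun i => cs.simple (c i)) (!b) n * w)
    rw [cs.length_simple] at length_simple_mul
    have := ih (!b)
    omega

open scoped Classical in
theorem altWord_nilConn_single_one (c : Bool → B) (b : Bool) (n : ℕ) (w : W) :
    altWord (fun i => connEnd (nilConn cs (c i))) b n (Finsupp.single w 1) =
      if cs.length (altWord (fun i => cs.simple (c i)) b n * w) = n + cs.length w then
        Finsupp.single (altWord (fun i => cs.simple (c i)) b n * w) 1 else 0 := by
  induction n generalizing b with
  | zero => rw [altWord_zero, altWord_zero, one_mul, zero_add, if_pos rfl, Module.End.one_apply]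
  | succ n ih =>
    rw [altWord_succ, Module.End.mul_apply, ih, altWord_succ, mul_assoc]
    set u := altWord (fun i => cs.simple (c i)) (!b) n * w
    have length_u : cs.length u ≤ n + cs.length w := length_altWord_mul_le cs c (!b) n w
    have length_simple_mul := cs.length_mul_le (cs.simple (c b)) u
    rw [cs.length_simple] at length_simple_mul
    by_cases h : cs.length u = n + cs.length w
    · rw [if_pos h, connEnd_apply, nilConn_single_one, h, Nat.add_right_comm]
    · rw [if_neg h, if_neg (by omega), map_zero]

theorem isNilHeckeModule_nilConn : IsNilHeckeModule (nilConn cs) where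
  nil := nilConn_nilConn cs
  braid := isBraided_connEnd_of_span (nilConn_nilConn cs) (span_range_single_one cs)
    fun c m hc hm b => Set.forall_mem_range.2 fun w => by
      rw [altWord_nilConn_single_one, altWord_nilConn_single_one, isBraided_simple cs hc hm]

/-- The span of the basis vectors of the nil Coxeter module which belong to elements of length
less than `n`. -/
def nilFiltration (n : ℕ) : Submodule (SymRing cs) (W →₀ SymRing cs) :=
  Finsupp.supported (SymRing cs) (SymRing cs) {w | cs.length w < n}

theorem single_mem_nilFiltration {n : ℕ} {w : W} (hw : cs.length w < n) (r : SymRing cs) :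
    Finsupp.single w r ∈ nilFiltration cs n :=
  Finsupp.single_mem_supported _ r hw

theorem nilConn_mem_nilFiltration (s : B) {n : ℕ} {v : W →₀ SymRing cs}
    (hv : v ∈ nilFiltration cs n) : nilConn cs s v ∈ nilFiltration cs (n + 1) := by
  rw [nilFiltration, Finsupp.supported_eq_span_single] at hv
  refine apply_mem_of_mem_span ?_ ?_ hv
  · rintro _ ⟨w, hw, rfl⟩
    exact single_mem_nilFiltration cs (Nat.lt_succ_of_lt hw) 1
  · rintro _ ⟨w, hw, rfl⟩
    rw [nilConn_single_one]
    split_ifs with h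
    · exact single_mem_nilFiltration cs (h.trans_lt (Nat.succ_lt_succ hw)) 1
    · exact zero_mem _

theorem nilConn_twist_mem_nilFiltration (s : B) {n : ℕ} {v : W →₀ SymRing cs}
    (hv : v ∈ nilFiltration cs n) : (nilConn cs s).twist v ∈ nilFiltration cs (n + 1) :=
  sub_mem (Finsupp.supported_mono (fun _ => Nat.lt_succ_of_lt) hv)
    (Submodule.smul_mem _ _ (nilConn_mem_nilFiltration cs s hv))

theorem nilConn_twist_single {s : B} {w : W}
    (hw : cs.length (cs.simple s * w) = cs.length w + 1) (r : SymRing cs) :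
    (nilConn cs s).twist (Finsupp.single w r) = Finsupp.single w (cs.simple s • r) -
      Finsupp.single (cs.simple s * w) (symRoot cs s * cs.simple s • r) := by
  rw [← mul_one r, ← smul_eq_mul, ← Finsupp.smul_single, twist_smul, twist, nilConn_single_one,
    if_pos hw]
  change (r - symRoot cs s * demazure cs s r) •
    (Finsupp.single w 1 - symRoot cs s • Finsupp.single (cs.simple s * w) 1) = _
  rw [sub_symRoot_mul_demazure, smul_sub, smul_smul, Finsupp.smul_single, Finsupp.smul_single,
    smul_eq_mul, smul_eq_mul, smul_eq_mul, mul_one, mul_one, mul_one, mul_comm (symRoot cs s)]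

theorem nilConn_twist_sub_single_mem {s : B} {w : W}
    (hw : cs.length (cs.simple s * w) = cs.length w + 1) {v : W →₀ SymRing cs} {c : SymRing cs}
    (hv : v - Finsupp.single w c ∈ nilFiltration cs (cs.length w)) :
    (nilConn cs s).twist v - Finsupp.single (cs.simple s * w) (-(symRoot cs s * cs.simple s • c)) ∈
      nilFiltration cs (cs.length (cs.simple s * w)) := by
  have twist_v : (nilConn cs s).twist v -
        Finsupp.single (cs.simple s * w) (-(symRoot cs s * cs.simple s • c)) =
      (nilConn cs s).twist (v - Finsupp.single w c) + Finsupp.single w (cs.simple s • c) := by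
    rw [twist_sub, nilConn_twist_single cs hw, Finsupp.single_neg]
    abel
  rw [twist_v, hw]
  exact add_mem (nilConn_twist_mem_nilFiltration cs s hv)
    (single_mem_nilFiltration cs (Nat.lt_succ_self _) _)

end NilCoxeterModule

/-! ### The twisted group algebra -/

section Subalgebroid

open SkewMonoidAlgebra

/-- The image of the Coxeter group in the nil Hecke algebra. -/
def groupElt : W →* NilHecke cs := cs.lift ⟨reflElt cs, reflElt_isLiftable cs⟩

theorem groupElt_simple (s : B) : groupElt cs (cs.simple s) = reflElt cs s :=
  cs.lift_apply_simple (reflElt_isLiftable cs) s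

theorem groupElt_simple_mul (s : B) (w : W) :
    groupElt cs (cs.simple s * w) = reflElt cs s * groupElt cs w := by
  rw [map_mul, groupElt_simple]

theorem groupElt_mul_sym (w : W) (r : SymRing cs) :
    groupElt cs w * symIncl cs r = symIncl cs (w • r) * groupElt cs w := by
  induction w using cs.simple_induction_left generalizing r with
  | one => rw [map_one, one_mul, mul_one, one_smul]
  | mul_simple_left w s hw =>
    rw [groupElt_simple_mul, mul_assoc, hw, ← delConn_twist, ← delConn_twist, ← sym_smul_def,
      twist_smul, sym_smul_def, mul_smul, ← sub_symRoot_mul_demazure]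
    rfl

theorem exists_leading_term_groupElt (w : W) : ∃ c ≠ 0,
    (isNilHeckeModule_nilConn cs).orbit (Finsupp.single 1 1) (groupElt cs w) -
      Finsupp.single w c ∈ nilFiltration cs (cs.length w) := by
  induction hn : cs.length w generalizing w with
  | zero =>
    obtain rfl := cs.length_eq_zero_iff.1 hn
    refine ⟨1, one_ne_zero, ?_⟩
    rw [map_one, IsNilHeckeModule.orbit_one, sub_self]
    exact zero_mem _
  | succ n ih =>
    obtain ⟨s, hs⟩ := cs.exists_leftDescent_of_ne_one (w := w)
      fun h => by rw [h, cs.length_one] at hn; omega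
    obtain ⟨u, rfl⟩ : ∃ u, w = cs.simple s * u :=
      ⟨cs.simple s * w, (cs.simple_mul_simple_cancel_left s).symm⟩
    rw [cs.isLeftDescent_iff, cs.simple_mul_simple_cancel_left] at hs
    obtain ⟨c, hc, hu⟩ := ih u (by omega)
    refine ⟨-(symRoot cs s * cs.simple s • c), neg_ne_zero.2 (mul_ne_zero (symRoot_ne_zero cs s)
      ((smul_ne_zero_iff_ne _).2 hc)), ?_⟩
    rw [← hn, groupElt_simple_mul, ← delConn_twist,
      (IsNilHeckeModule.intertwines_orbit _ _ s).map_twist]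
    exact nilConn_twist_sub_single_mem cs hs.symm (by rwa [show cs.length u = n by omega])

theorem linearIndependent_groupElt : LinearIndependent (SymRing cs) (groupElt cs) :=
  .of_comp ((isNilHeckeModule_nilConn cs).orbit (Finsupp.single 1 1))
    (linearIndependent_of_triangular cs.length (exists_leading_term_groupElt cs))

/-- The embedding of the twisted group algebra into the nil Hecke algebra. -/
def twistedIncl : SkewMonoidAlgebra (SymRing cs) W →ₐ[ℝ] NilHecke cs :=
  liftNCAlgHom (symIncl cs) (groupElt cs) fun {r w} => (groupElt_mul_sym cs w r).symm

theorem twistedIncl_single (w : W) (r : SymRing cs) :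
    twistedIncl cs (single w r) = r • groupElt cs w :=
  liftNC_single _ _ w r

theorem twistedIncl_eq_linearCombination (a : SkewMonoidAlgebra (SymRing cs) W) :
    twistedIncl cs a = Finsupp.linearCombination (SymRing cs) (groupElt cs) a.coeff := by
  induction a using SkewMonoidAlgebra.induction_on with
  | zero => rw [map_zero, coeff_zero, map_zero]
  | single w r => rw [twistedIncl_single, coeff_single, Finsupp.linearCombination_single]
  | add a b ha hb => rw [map_add, coeff_add, map_add, ha, hb]

theorem twistedIncl_smul (r : SymRing cs) (a : SkewMonoidAlgebra (SymRing cs) W) :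
    twistedIncl cs (r • a) = r • twistedIncl cs a := by
  rw [twistedIncl_eq_linearCombination, twistedIncl_eq_linearCombination, coeff_smul, map_smul]

theorem twistedIncl_injective : Function.Injective (twistedIncl cs) := fun a b h => by
  rw [twistedIncl_eq_linearCombination, twistedIncl_eq_linearCombination] at h
  exact coeff_injective (linearIndependent_groupElt cs h)

theorem polyRep_groupElt (w : W) (f : SymRing cs) : polyRep cs (groupElt cs w) f = w • f := by
  induction w using cs.simple_induction_left with
  | one => rw [map_one, map_one, one_smul, Module.End.one_apply]
  | mul_simple_left w s hw =>
    rw [groupElt_simple_mul, map_mul, Module.End.mul_apply, hw, polyRep_reflElt, mul_smul]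

theorem nhComulₗ_groupElt (w : W) :
    nhComulₗ cs (groupElt cs w) = groupElt cs w ⊗ₜ[SymRing cs] groupElt cs w := by
  induction w using cs.simple_induction_left with
  | one => rw [map_one, nhComulₗ_one]
  | mul_simple_left w s hw =>
    rw [groupElt_simple_mul, ← delConn_twist, (intertwines_nhComulₗ cs s).map_twist, hw, tensorConn,
      twist_tensor_tmul]

theorem twistedIncl_isHopfSubalgebroid : IsHopfSubalgebroid (R := SymRing cs) (twistedIncl cs) where
  isHopfAlgebroid := twisted_isHopfAlgebroid ℝ _ _
  injective := twistedIncl_injective cs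
  map_smul := twistedIncl_smul cs
  map_comul a := by
    induction a using SkewMonoidAlgebra.induction_on with
    | zero => simp only [map_zero]
    | single w r =>
      rw [comul_single, map_smul, TensorProduct.map_tmul]
      change nhComulₗ cs (twistedIncl cs (single w r)) =
        r • (twistedIncl cs (single w 1) ⊗ₜ twistedIncl cs (single w 1))
      rw [twistedIncl_single, twistedIncl_single, one_smul, map_smul, nhComulₗ_groupElt]
    | add a b ha hb => simp only [map_add, ha, hb]
  map_counit a := by
    induction a using SkewMonoidAlgebra.induction_on with
    | zero => simp only [map_zero]
    | single w r =>
      rw [counit_single, twistedIncl_single]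
      change polyEval cs 1 (r • groupElt cs w) = r
      rw [map_smul, polyEval_apply, polyRep_groupElt, smul_one, smul_eq_mul, mul_one]
    | add a b ha hb => simp only [map_add, ha, hb]

end Subalgebroid

end NilHecke

end

open NilHecke

theorem mainTheorem1 {B W : Type*} [Group W] {M : CoxeterMatrix B} (cs : CoxeterSystem M W) :
    ∃ (ρ : NilHecke cs →ₐ[ℝ] Module.End ℝ (SymRing cs))
      (Δ : NilHecke cs →ₐ[ℝ] takeuchi (SymRing cs) (NilHecke cs))
      (_ : Coalgebra (SymRing cs) (NilHecke cs))
      (hH : IsHopfAlgebroid ℝ (SymRing cs) (NilHecke cs))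
      (red : NilHecke cs →ₐ[ℝ] balTakeuchi (SymRing cs) (NilHecke cs))
      (j : SkewMonoidAlgebra (SymRing cs) W →ₐ[ℝ] NilHecke cs),
      -- the polynomial representation
      (∀ x f, ρ (wt cs x) f = symι cs x * f) ∧
      (∀ s f, symι cs (simpleRoot s) * ρ (del cs s) f = f - cs.simple s • f) ∧
      -- the comultiplication
      (∀ x, (Δ (wt cs x)).1 = symι cs x • (1 ⊗ₜ[SymRing cs] 1)) ∧
      (∀ s, (Δ (del cs s)).1 = del cs s ⊗ₜ[SymRing cs] reflElt cs s + 1 ⊗ₜ[SymRing cs] del cs s) ∧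
      (∀ s, (Δ (del cs s)).1 = del cs s ⊗ₜ[SymRing cs] 1 + reflElt cs s ⊗ₜ[SymRing cs] del cs s) ∧
      -- the cocommutative Hopf algebroid
      (∀ h, Coalgebra.comul (R := SymRing cs) h = (Δ h).1) ∧
      (∀ h, Coalgebra.counit (R := SymRing cs) h = ρ h 1) ∧
      Coalgebra.IsCocomm (SymRing cs) (NilHecke cs) ∧
      -- the translation map
      (∀ h, hH.red h = (red h).1) ∧
      (∀ x, (red (wt cs x)).1 = balTmul (SymRing cs) (NilHecke cs) (wt cs x) 1) ∧
      (∀ s, (red (del cs s)).1 = balTmul (SymRing cs) (NilHecke cs) (del cs s) (reflElt cs s) +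
        balTmul (SymRing cs) (NilHecke cs) 1 (del cs s)) ∧
      (∀ s, (red (del cs s)).1 = balTmul (SymRing cs) (NilHecke cs) (del cs s) 1 -
        balTmul (SymRing cs) (NilHecke cs) (reflElt cs s) (del cs s)) ∧
      -- the Hopf subalgebroid
      (∀ s, j (SkewMonoidAlgebra.single (cs.simple s) 1) = reflElt cs s) ∧
      IsHopfSubalgebroid (R := SymRing cs) j := by
  refine ⟨polyRep cs, nhComul cs, nhCoalgebra cs, nh_isHopfAlgebroid cs, nhRed cs, twistedIncl cs,
    fun x f => ?_, fun s f => ?_, fun x => ?_, nhComulₗ_del' cs, nhComulₗ_del cs, fun _ => rfl,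
    fun _ => rfl, nh_isCocomm cs, red_nh cs, fun x => ?_, nhRed_del cs, nhRed_del' cs,
    fun s => ?_, twistedIncl_isHopfSubalgebroid cs⟩
  · rw [← symIncl_ι, polyRep_sym]
  · rw [polyRep_del]
    exact symRoot_mul_demazure cs s f
  · rw [← symIncl_ι, nhComul_sym, coe_inclTakeuchi]
  · rw [← symIncl_ι, ← incl_nh, nhRed_incl]
  · rw [twistedIncl_single, groupElt_simple, one_smul]
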